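/- **Setting.** There are $N$ agents and $K$ arms with means $\mu_k\in[0,1]$ and a unique best arm $\star$, so $\mu_k<\mu_\star$ for $k\neq\star$. For $n\in[N]$, $k\in[K]$, $s\ge 1$ let $X^n_{k,s}\in\{0,1\}$ be the reward that agent $n$ receives when playing arm $k$ for the $s$-th time, with $X^n_{k,s}\sim\mathrm{Bernoulli}(\mu_k)$. Let $P$ be an $N\times N$ row-stochastic matrix and, for $n\in[N]$, $j\ge1$, let $Q^n_j\in[N]$ have distribution $P(n,\cdot)$. All the variables $X^n_{k,s}$, $Q^n_j$ are independent. Let $0=A_0<A_1<A_2<\dots$ be integers; phase $j\ge1$ consists of the rounds $A_{j-1}<t\le A_j$. The set $[K]$ is partitioned into nonempty sets $S^1_\circ,\dots,S^N_\circ$ (for instance of nearly equal size). Let $I^n_t$ be the arm played by agent $n$ in round $t\geq 1$, $V^n_k(t)=\sum_{s\le t}\mathbf 1\{I^n_s=k\}$, let $X^n(t)=X^n_{k,V^n_k(t)}$ with $k=I^n_t$ be the reward received in round $t$, and let $\hat\mu^n_k(t)$ be the mean of the first $V^n_k(t)$ rewards of agent $n$ from arm $k$. Let $\mathrm{KL}(p,q)\in[0,\infty]$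 be the Kullback–Leibler divergence between Bernoulli($p$) and Bernoulli($q$), and $f(t)=1+t\log^2 t$. Put $U^n_k(t-1)=\max\{u\in[0,1]:\mathrm{KL}(\hat\mu^n_k(t-1),u)\le \log f(t)/V^n_k(t-1)\}$ if $V^n_k(t-1)>0$ and $U^n_k(t-1)=\infty$ otherwise. **The AOGB algorithm.** Put $S^n_1=S^n_\circ$. In each round $t$ of phase $j$, agent $n$ plays an arm $I^n_t\in\arg\max_{k\in S^n_j}U^n_k(t-1)$. At the end of phase $j$, let $M^n_j\in\arg\max_{k\in[K]}\{V^n_k(A_j)-V^n_k(A_{j-1})\}$ be a most played arm of agent $n$ in that phase; agent $n$ receives from agent $Q^n_j$ the recommendation $O^n_j=M^{q}_j$, $q=Q^n_j$, and sets $S^n_{j+1}=S^n_\circ\cup\{O^n_j,M^n_j\}$. Ties are broken arbitrarily, but $I^n_t$ and $M^n_j$ must be measurable functions of the rewards and messages that agent $n$ has received before making the choice. The expected regret of agent $n$ is $\mathbb E[\mathcal R^n_T]=T\mu_\star-\sum_{t=1}^T\mathbb E[X^n(t)]$. **Theorem.** Suppose that the directed graph on $[N]$ with an edge $n\to q$ whenever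 $P(n,q)>0$ is strongly connected, and that there are $C\ge1$, $\theta>0$ with $C^{-1}j^\theta\le A_j-A_{j-1}\le Cj^\theta$ for all $j\ge1$. If all agents run the AOGB algorithm, then for each agent $n\in[N]$ $$\limsup_{T\to\infty}\frac{\mathbb E[\mathcal R^n_T]}{\log T}\le\sum_{k\in S^n_\circ\setminus\{\star\}}\frac{\mu_\star-\mu_k}{\mathrm{KL}(\mu_k,\mu_\star)},$$ where a term with $\mathrm{KL}(\mu_k,\mu_\star)=\infty$ is $0$. Summed over the agents, the total regret is asymptotically at most the Lai–Robbins constant, which is the constant in the lower bound for the full-communication setting: $$\limsup_{T\to\infty}\frac{\sum_{n=1}^N\mathbb E[\mathcal R^n_T]}{\log T}\le\sum_{k\ne\star}\frac{\mu_\star-\mu_k}{\mathrm{KL}(\mu_k,\mu_\star)}.$$ -/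

import Mathlib

open MeasureTheory ProbabilityTheory Filter Finset
open scoped ENNReal

namespace AOGB

variable {Ω : Type*} {N K : ℕ}

/-! Times `t`, phases `j` and play numbers `s` start at `1`; the values of the sequences below at
index `0` play no role, except that `A 0 = 0`. -/

/-- Kullback-Leibler divergence `KL(p, q)` between the Bernoulli distributions with means
`p, q ∈ [0, 1]`: it is `∞` if Bernoulli(`p`) is not absolutely continuous with respect to
Bernoulli(`q`), and `p log (p / q) + (1 - p) log ((1 - p) / (1 - q))` (with `0 log 0 = 0`)
otherwise. -/
noncomputable def klBer (p q : ℝ) : ℝ≥0∞ :=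
  if (q = 0 ∧ p ≠ 0) ∨ (q = 1 ∧ p ≠ 1) then ∞
  else ENNReal.ofReal (p * Real.log (p / q) + (1 - p) * Real.log ((1 - p) / (1 - q)))

/-- `klBer` is Mathlib's Kullback-Leibler divergence of Bernoulli measures. -/
theorem klBer_eq_klDiv (p q : unitInterval) :
    klBer p q = InformationTheory.klDiv (bernoulliMeasure (1 : ℝ) 0 p)
      (bernoulliMeasure (1 : ℝ) 0 q) := by
  unfold klBer
  have hp := p.2
  have hq := q.2
  split_ifs with h
  · symm
    apply InformationTheory.klDiv_of_not_ac
    intro hac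
    rcases h with ⟨h1, h2⟩ | ⟨h1, h2⟩
    · have := hac (s := {1}) (by
        rw [bernoulliMeasure_apply_of_mem_of_notMem _ (measurableSet_singleton _) (by simp) (by simp)]
        have : q = 0 := by ext; simpa using h1
        simp [this])
      rw [bernoulliMeasure_apply_of_mem_of_notMem _ (measurableSet_singleton _) (by simp) (by simp)] at this
      apply h2
      have : (unitInterval.toNNReal p : ℝ) = 0 := by exact_mod_cast this
      simpa using this
    · have := hac (s := {0}) (by
        rw [bernoulliMeasure_apply_of_notMem_of_mem _ (measurableSet_singleton _) (by simp) (by simp)]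
        have : q = 1 := by ext; simpa using h1
        simp [this])
      rw [bernoulliMeasure_apply_of_notMem_of_mem _ (measurableSet_singleton _) (by simp) (by simp)] at this
      apply h2
      have : (unitInterval.toNNReal (unitInterval.symm p) : ℝ) = 0 := by exact_mod_cast this
      simp at this
      linarith
  · push Not at h
    set ν := bernoulliMeasure (1 : ℝ) 0 q with hν
    set f : ℝ → ℝ≥0∞ := fun x ↦ if x = 1 then ENNReal.ofReal (p / q)
      else ENNReal.ofReal ((1 - p) / (1 - q)) with hf
    have hfm : Measurable f := Measurable.ite (measurableSet_singleton _) measurable_const measurable_const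
    have key : bernoulliMeasure (1 : ℝ) 0 p = ν.withDensity f := by
      ext s hs
      classical
      rw [withDensity_apply _ hs, ← lintegral_indicator hs, hν, bernoulliMeasure_def, bernoulliMeasure_def]
      rw [lintegral_add_measure]
      simp only [ENNReal.smul_def, lintegral_smul_measure, lintegral_dirac]
      have e1 : (unitInterval.toNNReal p : ℝ≥0∞) = unitInterval.toNNReal q * ENNReal.ofReal (p / q) := by
        have : ∀ r : unitInterval, (unitInterval.toNNReal r : ℝ≥0∞) = ENNReal.ofReal r := by
          intro r; rw [ENNReal.ofReal_eq_coe_nnreal r.2.1]; rfl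
        rw [this, this, ← ENNReal.ofReal_mul hq.1]
        congr 1
        by_cases h0 : (q : ℝ) = 0
        · simp [h0, h.1 h0]
        · field_simp
      have e2 : (unitInterval.toNNReal (unitInterval.symm p) : ℝ≥0∞) = unitInterval.toNNReal (unitInterval.symm q) * ENNReal.ofReal ((1-p) / (1-q)) := by
        have : ∀ r : unitInterval, (unitInterval.toNNReal r : ℝ≥0∞) = ENNReal.ofReal r := by
          intro r; rw [ENNReal.ofReal_eq_coe_nnreal r.2.1]; rfl
        rw [this, this, ← ENNReal.ofReal_mul (unitInterval.symm q).2.1]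
        congr 1
        simp only [unitInterval.coe_symm_eq]
        by_cases h0 : (q : ℝ) = 1
        · simp [h0, h.2 h0]
        · have : (1 - q : ℝ) ≠ 0 := by intro h'; apply h0; linarith
          field_simp
      simp only [Measure.add_apply, Measure.smul_apply, Measure.dirac_apply' _ hs, ENNReal.smul_def, smul_eq_mul]
      rw [e1, e2]
      by_cases h1 : (1:ℝ) ∈ s <;> by_cases h2 : (0:ℝ) ∈ s <;> simp [h1, h2, hf]
    have hac : bernoulliMeasure (1 : ℝ) 0 p ≪ ν := key ▸ withDensity_absolutelyContinuous _ _
    have hllr : llr (bernoulliMeasure (1 : ℝ) 0 p) ν =ᵐ[bernoulliMeasure (1 : ℝ) 0 p] fun x ↦ Real.log (f x).toReal := by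
      apply hac.ae_le
      have := Measure.rnDeriv_withDensity ν hfm
      rw [← key] at this
      filter_upwards [this] with x hx
      simp [llr, hx]
    rw [InformationTheory.klDiv_of_ac_of_integrable hac, integral_congr_ae hllr, integral_bernoulliMeasure]
    · congr 1
      have h1 : 0 ≤ (p / q : ℝ) := div_nonneg hp.1 hq.1
      have h2 : 0 ≤ ((1 - p) / (1 - q) : ℝ) := div_nonneg (by linarith [hp.2]) (by linarith [hq.2])
      simp [hf, ENNReal.toReal_ofReal, h1, h2, hν]
    · exact (integrable_congr hllr).2 (integrable_bernoulliMeasure _ _ _ _)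

/-- The exploration function `f(t) = 1 + t log² t`. -/
noncomputable def explore (t : ℕ) : ℝ := 1 + t * Real.log t ^ 2

/-- `V^n_k(t)`: how often agent `n` has played arm `k` in rounds `1, …, t`, where `I n t` is the arm
played by agent `n` in round `t`. -/
def playCount (I : Fin N → ℕ → Ω → Fin K) (n : Fin N) (k : Fin K) (t : ℕ) (ω : Ω) : ℕ :=
  #{s ∈ Icc 1 t | I n s ω = k}

/-- `X^n(t)`: the reward of agent `n` in round `t`, where `X n k s` is the reward that agent `n`
receives when playing arm `k` for the `s`-th time. -/
def reward (X : Fin N → Fin K → ℕ → Ω → ℝ) (I : Fin N → ℕ → Ω → Fin K)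
    (n : Fin N) (t : ℕ) (ω : Ω) : ℝ :=
  X n (I n t ω) (playCount I n (I n t ω) t ω) ω

/-- The average of the first `s` rewards of agent `n` from arm `k`. -/
noncomputable def sampleMean (X : Fin N → Fin K → ℕ → Ω → ℝ)
    (n : Fin N) (k : Fin K) (s : ℕ) (ω : Ω) : ℝ :=
  (∑ i ∈ Icc 1 s, X n k i ω) / s

/-- The KL upper confidence bound `U^n_k(t - 1)` that agent `n` uses for arm `k` in round `t ≥ 1`.
It is `∞` if the arm has not been played before; otherwise it is the largest `u ∈ [0, 1]` with
`KL(sample mean, u) ≤ log f(t) / V^n_k(t - 1)` (the supremum is attained, as `KL(p, ·)` is lower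
semicontinuous on `[0, 1]` and `KL(p, p) = 0`). -/
noncomputable def ucb (X : Fin N → Fin K → ℕ → Ω → ℝ) (I : Fin N → ℕ → Ω → Fin K)
    (n : Fin N) (k : Fin K) (t : ℕ) (ω : Ω) : EReal :=
  let v := playCount I n k (t - 1) ω
  if v = 0 then ⊤
  else ((sSup {u : ℝ | u ∈ Set.Icc 0 1 ∧
    klBer (sampleMean X n k v ω) u ≤ ENNReal.ofReal (Real.log (explore t) / v)} : ℝ) : EReal)

/-- The recommendation that agent `n` receives at the end of phase `j`: the sender is `Q n j`, and
each agent recommends the arm `M · j` that it has played most in phase `j`. -/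
def recommendation (M : Fin N → ℕ → Ω → Fin K) (Q : Fin N → ℕ → Ω → Fin N)
    (n : Fin N) (j : ℕ) (ω : Ω) : Fin K :=
  M (Q n j ω) j ω

/-- The active set `S^n_j` of agent `n` in phase `j`: the sticky set in the first phase, and
afterwards the sticky set together with the recommendation received at the end of the preceding
phase and the agent's own most played arm of that phase. -/
def activeSet (S₀ : Fin N → Finset (Fin K)) (M : Fin N → ℕ → Ω → Fin K)
    (Q : Fin N → ℕ → Ω → Fin N) (n : Fin N) : ℕ → Ω → Finset (Fin K)
  | 0, _ => S₀ n
  | 1, _ => S₀ n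
  | j + 2, ω => S₀ n ∪ {recommendation M Q n (j + 1) ω, M n (j + 1) ω}

/-- The information of agent `n` given by its rewards in rounds `1, …, t` and the messages it has
received at the ends of phases `1, …, j`. -/
abbrev history (X : Fin N → Fin K → ℕ → Ω → ℝ) (Q : Fin N → ℕ → Ω → Fin N)
    (I M : Fin N → ℕ → Ω → Fin K) (n : Fin N) (t j : ℕ) : MeasurableSpace Ω :=
  (⨆ s ∈ Icc 1 t, MeasurableSpace.comap (reward X I n s) inferInstance) ⊔
  (⨆ i ∈ Icc 1 j, MeasurableSpace.comap (recommendation M Q n i) inferInstance)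

/-- The random environment: the rewards `X n k s` (`s ≥ 1`) are `{0, 1}`-valued and Bernoulli with
mean `μ k`, the sender `Q n j` (`j ≥ 1`) contacted by agent `n` at the end of phase `j` has
distribution `P n ·`, and all these random variables are independent. -/
structure IsEnvironment [MeasurableSpace Ω] (Pr : Measure Ω) (μ : Fin K → unitInterval)
    (P : Matrix (Fin N) (Fin N) ℝ) (X : Fin N → Fin K → ℕ → Ω → ℝ)
    (Q : Fin N → ℕ → Ω → Fin N) : Prop where
  measurable_reward : ∀ n k s, 1 ≤ s → Measurable (X n k s)
  reward_mem : ∀ n k s, 1 ≤ s → ∀ ω, X n k s ω = 0 ∨ X n k s ω = 1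
  reward_law : ∀ n k s, 1 ≤ s → Pr.map (X n k s) = bernoulliMeasure 1 0 (μ k)
  measurable_sender : ∀ n j, 1 ≤ j → Measurable (Q n j)
  sender_law : ∀ n j, 1 ≤ j → ∀ q, Pr {ω | Q n j ω = q} = ENNReal.ofReal (P n q)
  indep_reward : iIndepFun (fun (i : Fin N × Fin K × ℕ) ↦ X i.1 i.2.1 (i.2.2 + 1)) Pr
  indep_sender : iIndepFun (fun (i : Fin N × ℕ) ↦ Q i.1 (i.2 + 1)) Pr
  indep_reward_sender :
    IndepFun (fun ω (i : Fin N × Fin K × ℕ) ↦ X i.1 i.2.1 (i.2.2 + 1) ω)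
      (fun ω (i : Fin N × ℕ) ↦ Q i.1 (i.2 + 1) ω) Pr

/-- All agents run the algorithm, with phases `A (j - 1) < t ≤ A j`, sticky sets `S₀`, arms `I n t`
played and most played arms `M n j`. Ties in the two maximisations may be broken in any way that is
a function of what the agent knows at that time: its past rewards and received messages. -/
structure IsRun (A : ℕ → ℕ) (S₀ : Fin N → Finset (Fin K)) (X : Fin N → Fin K → ℕ → Ω → ℝ)
    (Q : Fin N → ℕ → Ω → Fin N) (I M : Fin N → ℕ → Ω → Fin K) : Prop where
  play_mem : ∀ n j t, 1 ≤ j → A (j - 1) < t → t ≤ A j → ∀ ω, I n t ω ∈ activeSet S₀ M Q n j ω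
  play_max : ∀ n j t, 1 ≤ j → A (j - 1) < t → t ≤ A j → ∀ ω, ∀ k ∈ activeSet S₀ M Q n j ω,
    ucb X I n k t ω ≤ ucb X I n (I n t ω) t ω
  play_measurable : ∀ n j t, 1 ≤ j → A (j - 1) < t → t ≤ A j →
    Measurable[history X Q I M n (t - 1) (j - 1)] (I n t)
  mostPlayed_max : ∀ n j, 1 ≤ j → ∀ ω k,
    playCount I n k (A j) ω - playCount I n k (A (j - 1)) ω ≤
      playCount I n (M n j ω) (A j) ω - playCount I n (M n j ω) (A (j - 1)) ω
  mostPlayed_measurable : ∀ n j, 1 ≤ j → Measurable[history X Q I M n (A j) (j - 1)] (M n j)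

/-- The expected regret `T μ_⋆ - ∑_{t ≤ T} E[X^n(t)]` of agent `n`, where `μstar` is the mean of the
best arm. -/
noncomputable def regret [MeasurableSpace Ω] (Pr : Measure Ω) (μstar : ℝ)
    (X : Fin N → Fin K → ℕ → Ω → ℝ) (I : Fin N → ℕ → Ω → Fin K) (n : Fin N) (T : ℕ) : ℝ :=
  T * μstar - ∑ t ∈ Icc 1 T, ∫ ω, reward X I n t ω ∂Pr

end AOGB

/-! The regret comes from plays of suboptimal arms. Fix thresholds μ_k < x_k ≤ ν < ν' < q ≤ μ_⋆ and
d_k ≤ KL(x_k, ν). If the best arm is active and its index is at least ν', any arm that is played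
also has index at least ν'. Unless its sample mean exceeds x_k, it has then been played at most log
f(t) / d_k times (`playCount_le_of_le_ucb`). The sample mean exceeds x_k for a bounded expected
number of sample sizes, and (μ_⋆ - μ_k) / d_k can be brought below (μ_⋆ - μ_k) / KL(μ_k, μ_⋆) plus
any positive error, which gives the constant.

Gossip makes only sticky arms count. While the best arm is active at an agent, the other arms take
only a small share of a long phase, so the best arm is the most played one; it is kept and
recommended (`mostPlayed_eq`). It spreads backwards along walks to the agent that holds it in its
sticky set. Once all agents recommend it, each active set is the sticky set plus the best arm
(`activeSet_of_notMem_badEvent`), and a nonsticky suboptimal arm is played only in exceptional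
phases.

Exceptional phases must cost O(1) rounds in expectation: the failure probability at scale h,
weighted by the phase length h^θ, has to be summable (`exists_exceptional_events`). The critical
failure is a low index of the best arm, of probability O(1 / f(A_h)) by `measureReal_indexLow_le`.
Since A_h is at least of order h^(1+θ), the weighted term is O(1 / (h log² h)), and the factor log²
t in f gives convergence. High sample means cost exp(-c h^θ), missing contacts a geometric term.

Plays are converted to regret pathwise (`sub_sum_reward_le`), without a martingale: Hoeffding's
inequality bounds all partial sums by a small linear term and an excess of bounded expectation. -/

namespace AOGB

/-! ### Bernoulli divergence and the exploration function -/

/-- The real-valued Kullback-Leibler divergence between Bernoulli distributions. -/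
noncomputable def klReal (p q : ℝ) : ℝ :=
  p * Real.log (p / q) + (1 - p) * Real.log ((1 - p) / (1 - q))

theorem klReal_self (p : ℝ) : klReal p p = 0 := by
  unfold klReal
  rcases eq_or_ne p 0 with h | h
  · simp [h]
  rcases eq_or_ne (1 - p) 0 with h' | h'
  · simp [h', div_self h]
  · simp [div_self h, div_self h']

theorem mul_log_div {p q : ℝ} (hq : q ≠ 0) :
    p * Real.log (p / q) = p * Real.log p - p * Real.log q := by
  rcases eq_or_ne p 0 with h | h
  · simp [h]
  · rw [Real.log_div h hq]; ring

theorem klReal_eq {p q : ℝ} (hq : q ≠ 0) (hq' : q ≠ 1) :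
    klReal p q = p * Real.log p + (1 - p) * Real.log (1 - p)
      - p * Real.log q - (1 - p) * Real.log (1 - q) := by
  unfold klReal
  rw [mul_log_div hq, mul_log_div (sub_ne_zero.2 hq'.symm)]
  ring

theorem sub_le_mul_log_div {p q : ℝ} (hp : 0 ≤ p) (hq : 0 < q) : p - q ≤ p * Real.log (p / q) := by
  rcases hp.eq_or_lt with rfl | hp
  · simp [hq.le]
  · have h := Real.one_sub_inv_le_log_of_pos (div_pos hp hq)
    calc p - q = p * (1 - (p / q)⁻¹) := by field_simp
      _ ≤ _ := mul_le_mul_of_nonneg_left h hp.le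

theorem klReal_nonneg {p q : ℝ} (hp : 0 ≤ p) (hp' : p ≤ 1) (hq : 0 < q) (hq' : q < 1) :
    0 ≤ klReal p q := by
  have h1 := sub_le_mul_log_div hp hq
  have h2 := sub_le_mul_log_div (sub_nonneg.2 hp') (sub_pos.2 hq')
  unfold klReal
  linarith

theorem klReal_pos {p q : ℝ} (hp : 0 < p) (hpq : p < q) (hq' : q < 1) : 0 < klReal p q := by
  have hq : 0 < q := hp.trans hpq
  have h2 := sub_le_mul_log_div (p := 1 - p) (by linarith) (sub_pos.2 hq')
  have h1 : p - q < p * Real.log (p / q) := by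
    have hne : q / p ≠ 1 := by rw [Ne, div_eq_one_iff_eq hp.ne']; exact hpq.ne'
    have h := Real.log_lt_sub_one_of_pos (div_pos hq hp) hne
    have e : Real.log (p / q) = - Real.log (q / p) := by
      rw [← Real.log_inv, inv_div]
    rw [e]
    have : p * Real.log (q / p) < p * (q / p - 1) := mul_lt_mul_of_pos_left h hp
    have e2 : p * (q / p - 1) = q - p := by field_simp
    linarith
  unfold klReal
  linarith

/-- The three-point inequality for the Bernoulli divergence. -/
theorem klReal_add_le {p q r : ℝ} (hq0 : 0 < q) (hpq : p ≤ q) (hqr : q ≤ r) (hr : r < 1) :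
    klReal p q + klReal q r ≤ klReal p r := by
  have hr0 : 0 < r := hq0.trans_le hqr
  have hq1 : q < 1 := hqr.trans_lt hr
  rw [klReal_eq hq0.ne' hq1.ne, klReal_eq hr0.ne' hr.ne, klReal_eq hr0.ne' hr.ne]
  have h1 : Real.log q ≤ Real.log r := Real.log_le_log hq0 hqr
  have h2 : Real.log (1 - r) ≤ Real.log (1 - q) := Real.log_le_log (by linarith) (by linarith)
  nlinarith [mul_nonneg (sub_nonneg.2 hpq) (sub_nonneg.2 h1),
    mul_nonneg (sub_nonneg.2 hpq) (sub_nonneg.2 h2)]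

theorem klReal_mono_right {p q r : ℝ} (hq0 : 0 < q) (hpq : p ≤ q) (hqr : q ≤ r)
    (hr : r < 1) : klReal p q ≤ klReal p r := by
  have := klReal_add_le hq0 hpq hqr hr
  have := klReal_nonneg hq0.le (by linarith) (hq0.trans_le hqr) hr
  linarith

theorem klReal_anti_left {p q r : ℝ} (hp : 0 ≤ p) (hq0 : 0 < q) (hpq : p ≤ q) (hqr : q ≤ r)
    (hr : r < 1) : klReal q r ≤ klReal p r := by
  have := klReal_add_le hq0 hpq hqr hr
  have := klReal_nonneg hp (by linarith) hq0 (hqr.trans_lt hr)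
  linarith

theorem continuous_klReal_left {q : ℝ} (hq : q ≠ 0) (hq' : q ≠ 1) :
    Continuous fun p ↦ klReal p q := by
  have : (fun p ↦ klReal p q) = fun p ↦ p * Real.log p + (1 - p) * Real.log (1 - p)
      - p * Real.log q - (1 - p) * Real.log (1 - q) := by
    funext p; exact klReal_eq hq hq'
  rw [this]
  have h1 : Continuous fun p : ℝ ↦ p * Real.log p := Real.continuous_mul_log
  have h2 : Continuous fun p : ℝ ↦ (1 - p) * Real.log (1 - p) :=
    h1.comp (continuous_const.sub continuous_id)
  fun_prop

theorem klBer_eq_ofReal {p q : ℝ} (hq : 0 < q) (hq' : q < 1) :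
    klBer p q = ENNReal.ofReal (klReal p q) := by
  unfold klBer klReal
  rw [if_neg]
  rintro (⟨h, -⟩ | ⟨h, -⟩) <;> linarith

theorem klBer_self (p : ℝ) : klBer p p = 0 := by
  unfold klBer
  rw [if_neg (by tauto)]
  change ENNReal.ofReal (klReal p p) = 0
  simp [klReal_self]

theorem klBer_pos {p q : ℝ} (hp : 0 ≤ p) (hpq : p < q) (hq : q ≤ 1) : 0 < klBer p q := by
  rcases hq.eq_or_lt with rfl | hq
  · unfold klBer
    rw [if_pos (Or.inr ⟨rfl, hpq.ne⟩)]
    simp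
  -- The midpoint stands in for `p`, which may be 0, where `klReal_pos` does not apply.
  · have hm : 0 < (p + q) / 2 := by linarith
    rw [klBer_eq_ofReal (hp.trans_lt hpq) hq, ENNReal.ofReal_pos]
    refine (klReal_pos hm (by linarith : (p + q) / 2 < q) hq).trans_le ?_
    exact klReal_anti_left hp hm (by linarith) (by linarith) hq

/-- Divergence lower bounds are stable under small perturbations of both means. -/
theorem exists_lt_klReal {p r d : ℝ} (hp : 0 ≤ p) (hpr : p < r) (hr : r ≤ 1)
    (hd : ENNReal.ofReal d < klBer p r) :
    ∃ x y, p < x ∧ x < y ∧ y < r ∧ d < klReal x y := by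
  obtain ⟨y, hpy, hyr, hy⟩ : ∃ y, p < y ∧ y < r ∧ d < klReal p y := by
    have key : ∀ᶠ y in nhdsWithin r (Set.Iio r), d < klReal p y := by
      -- At `r = 1` the divergence is infinite because `p < 1`; the term -(1 - p) log (1 - y) then
      -- makes `klReal p y` exceed any `d` as y tends to 1. For `r < 1` continuity suffices.
      rcases hr.eq_or_lt with rfl | hr
      · have hlog : Tendsto (fun y : ℝ ↦ Real.log (1 - y)) (nhdsWithin 1 (Set.Iio 1)) atBot := by
          refine Real.tendsto_log_nhdsGT_zero.comp ?_
          refine tendsto_nhdsWithin_iff.2 ⟨?_, ?_⟩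
          · have : Tendsto (fun y : ℝ ↦ 1 - y) (nhds 1) (nhds (1 - 1)) :=
              tendsto_const_nhds.sub tendsto_id
            rw [sub_self] at this
            exact this.mono_left nhdsWithin_le_nhds
          · filter_upwards [self_mem_nhdsWithin] with y hy
            simpa using hy
        have h1 : Tendsto (fun y : ℝ ↦ -((1 - p) * Real.log (1 - y)))
            (nhdsWithin 1 (Set.Iio 1)) atTop :=
          tendsto_neg_atBot_atTop.comp (hlog.const_mul_atBot (by linarith))
        have h2 := h1.eventually_gt_atTop (d - (p * Real.log p + (1 - p) * Real.log (1 - p)))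
        filter_upwards [h2, Ioo_mem_nhdsLT (show (0:ℝ) < 1 by norm_num)] with y hy hy'
        rw [klReal_eq hy'.1.ne' hy'.2.ne]
        have : p * Real.log y ≤ 0 := mul_nonpos_of_nonneg_of_nonpos hp
          (Real.log_nonpos hy'.1.le hy'.2.le)
        linarith
      · have hr0 : 0 < r := hp.trans_lt hpr
        rw [klBer_eq_ofReal hr0 hr] at hd
        have hd' : d < klReal p r := (ENNReal.ofReal_lt_ofReal_iff'.1 hd).1
        have hc : ContinuousAt (fun y ↦ klReal p y) r := by
          have : (fun y ↦ p * Real.log p + (1 - p) * Real.log (1 - p)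
              - p * Real.log y - (1 - p) * Real.log (1 - y)) =ᶠ[nhds r] fun y ↦ klReal p y := by
            filter_upwards [Ioo_mem_nhds hr0 hr] with y hy
            rw [klReal_eq hy.1.ne' hy.2.ne]
          refine ContinuousAt.congr ?_ this
          have := Real.continuousAt_log hr0.ne'
          have h2 : ContinuousAt (fun y ↦ Real.log (1 - y)) r :=
            ContinuousAt.log (by fun_prop) (by linarith)
          fun_prop
        exact (hc.eventually (lt_mem_nhds hd')).filter_mono nhdsWithin_le_nhds
    obtain ⟨y, h1, h2⟩ := (key.and (Ioo_mem_nhdsLT hpr)).exists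
    exact ⟨y, h2.1, h2.2, h1⟩
  have hy0 : 0 < y := hp.trans_lt hpy
  have hy1 : y < 1 := hyr.trans_le hr
  have key : ∀ᶠ x in nhdsWithin p (Set.Ioi p), d < klReal x y :=
    (((continuous_klReal_left hy0.ne' hy1.ne).tendsto p).eventually (lt_mem_nhds hy)).filter_mono
      nhdsWithin_le_nhds
  obtain ⟨x, h1, h2⟩ := (key.and (Ioo_mem_nhdsGT hpy)).exists
  exact ⟨x, y, h2.1, h2.2, hyr, h1⟩

theorem explore_mono {s t : ℕ} (h : s ≤ t) : explore s ≤ explore t := by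
  unfold explore
  rcases Nat.eq_zero_or_pos s with rfl | hs
  · simp; positivity
  have h0 : (1 : ℝ) ≤ s := by exact_mod_cast hs
  have h1 : (s : ℝ) ≤ t := by exact_mod_cast h
  have h2 : 0 ≤ Real.log s := Real.log_nonneg h0
  have h3 : Real.log s ≤ Real.log t := Real.log_le_log (by linarith) h1
  gcongr

theorem one_le_explore (t : ℕ) : 1 ≤ explore t := by
  unfold explore
  have : 0 ≤ (t : ℝ) * Real.log t ^ 2 := by positivity
  linarith

theorem log_explore_nonneg (t : ℕ) : 0 ≤ Real.log (explore t) :=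
  Real.log_nonneg (one_le_explore t)

theorem log_explore_mono {s t : ℕ} (h : s ≤ t) :
    Real.log (explore s) ≤ Real.log (explore t) :=
  Real.log_le_log (by linarith [one_le_explore s]) (explore_mono h)

theorem log_explore_le {t : ℕ} (ht : 3 ≤ t) :
    Real.log (explore t) ≤ Real.log t + 2 * Real.log (Real.log t) + 1 := by
  have ht' : (3 : ℝ) ≤ t := by exact_mod_cast ht
  have h1 : 1 ≤ Real.log t := by
    rw [Real.le_log_iff_exp_le (by linarith)]
    linarith [Real.exp_one_lt_d9]
  have h2 : explore t ≤ t * Real.log t ^ 2 * Real.exp 1 := by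
    unfold explore
    have h3 : 1 ≤ (t : ℝ) * Real.log t ^ 2 := by nlinarith
    have h4 : 2 ≤ Real.exp 1 := by linarith [Real.exp_one_gt_d9]
    nlinarith
  calc Real.log (explore t) ≤ Real.log (t * Real.log t ^ 2 * Real.exp 1) :=
        Real.log_le_log (by linarith [one_le_explore t]) h2
    _ = _ := by
        rw [Real.log_mul (by positivity) (by positivity), Real.log_mul (by positivity)
          (by positivity), Real.log_pow, Real.log_exp]
        push_cast; ring

theorem tendsto_log_explore_div_log :
    Tendsto (fun t : ℕ ↦ Real.log (explore t) / Real.log t) atTop (nhds 1) := by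
  have hlog : Tendsto (fun t : ℕ ↦ Real.log t) atTop atTop :=
    Real.tendsto_log_atTop.comp tendsto_natCast_atTop_atTop
  have h1 : Tendsto (fun y : ℝ ↦ 1 + 2 * (Real.log y / y) + 1 / y) atTop
      (nhds (1 + 2 * 0 + 0)) := by
    have : Tendsto (fun y : ℝ ↦ Real.log y / y) atTop (nhds 0) :=
      Real.isLittleO_log_id_atTop.tendsto_div_nhds_zero
    have h' : Tendsto (fun y : ℝ ↦ 1 / y) atTop (nhds 0) := by
      simpa using tendsto_inv_atTop_zero
    exact (tendsto_const_nhds.add (this.const_mul 2)).add h'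
  have h2 := h1.comp hlog
  norm_num at h2
  refine tendsto_of_tendsto_of_tendsto_of_le_of_le' tendsto_const_nhds h2 ?_ ?_
  · filter_upwards [eventually_ge_atTop 3] with t ht
    have ht' : (3 : ℝ) ≤ t := by exact_mod_cast ht
    have h1 : 1 ≤ Real.log t := by
      rw [Real.le_log_iff_exp_le (by linarith)]
      linarith [Real.exp_one_lt_d9]
    rw [le_div_iff₀ (by linarith), one_mul]
    apply Real.log_le_log (by linarith)
    unfold explore
    have h2 : 1 ≤ Real.log t ^ 2 := one_le_pow₀ h1
    nlinarith
  · filter_upwards [eventually_ge_atTop 3] with t ht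
    have ht' : (3 : ℝ) ≤ t := by exact_mod_cast ht
    have h1 : 1 ≤ Real.log t := by
      rw [Real.le_log_iff_exp_le (by linarith)]
      linarith [Real.exp_one_lt_d9]
    have := log_explore_le ht
    simp only [Function.comp]
    rw [div_le_iff₀ (by linarith)]
    field_simp
    linarith

end AOGB

/-! ### Concentration of rewards and probability of missed contacts -/

namespace AOGB

theorem sum_Icc_one_eq_sum_range {β : Type*} [AddCommMonoid β] (f : ℕ → β) (s : ℕ) :
    ∑ i ∈ Icc 1 s, f i = ∑ i ∈ range s, f (i + 1) := by
  rw [range_eq_Ico, sum_Ico_add' f 0 s 1]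
  rfl

/-- The index of agent `n`'s arm `k` is too low at level `t` for some number of plays. -/
def indexLow {Ω : Type*} {N K : ℕ} (X : Fin N → Fin K → ℕ → Ω → ℝ) (ν : ℝ) (n : Fin N)
    (k : Fin K) (t : ℕ) : Set Ω :=
  {ω | ∃ s, 1 ≤ s ∧ sampleMean X n k s ω < ν ∧
    Real.log (explore t) / s < klReal (sampleMean X n k s ω) ν}

/-- Some sample mean after at least `m` plays exceeds `x`. -/
def meanHigh {Ω : Type*} {N K : ℕ} (X : Fin N → Fin K → ℕ → Ω → ℝ) (x : ℝ) (n : Fin N)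
    (k : Fin K) (m : ℕ) : Set Ω :=
  {ω | ∃ s, m ≤ s ∧ 1 ≤ s ∧ x < sampleMean X n k s ω}

/-- Agent `n` does not contact agent `q` at the ends of the phases `a + 1, …, a + h`. -/
def noContact {Ω : Type*} {N : ℕ} (Q : Fin N → ℕ → Ω → Fin N) (n q : Fin N) (a h : ℕ) : Set Ω :=
  {ω | ∀ j, a < j → j ≤ a + h → Q n j ω ≠ q}

namespace IsEnvironment

variable {Ω : Type*} [MeasurableSpace Ω] {Pr : Measure Ω}
  {N K : ℕ} {μ : Fin K → unitInterval} {P : Matrix (Fin N) (Fin N) ℝ}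
  {X : Fin N → Fin K → ℕ → Ω → ℝ} {Q : Fin N → ℕ → Ω → Fin N}

theorem reward_mem_Icc (henv : IsEnvironment Pr μ P X Q) (n : Fin N) (k : Fin K) {s : ℕ}
    (hs : 1 ≤ s) (ω : Ω) : X n k s ω ∈ Set.Icc (0 : ℝ) 1 := by
  rcases henv.reward_mem n k s hs ω with h | h <;> simp [h]

theorem integral_reward (henv : IsEnvironment Pr μ P X Q) (n : Fin N) (k : Fin K) {s : ℕ}
    (hs : 1 ≤ s) : ∫ ω, X n k s ω ∂Pr = μ k := by
  have h : ∫ x, x ∂(Pr.map (X n k s)) = ∫ ω, X n k s ω ∂Pr :=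
    integral_map (henv.measurable_reward n k s hs).aemeasurable (by fun_prop)
  rw [← h, henv.reward_law n k s hs, integral_bernoulliMeasure]
  simp

theorem iIndepFun_reward (henv : IsEnvironment Pr μ P X Q) (n : Fin N) (k : Fin K) :
    iIndepFun (fun i : ℕ ↦ X n k (i + 1)) Pr :=
  henv.indep_reward.precomp (g := fun i : ℕ ↦ (n, k, i)) fun i j h ↦ by simpa using h

theorem measurable_sampleMean (henv : IsEnvironment Pr μ P X Q) (n : Fin N) (k : Fin K) (s : ℕ) :
    Measurable (sampleMean X n k s) := by
  unfold sampleMean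
  refine Measurable.div_const ?_ _
  exact Finset.measurable_fun_sum _ fun i hi ↦ henv.measurable_reward n k i (mem_Icc.1 hi).1

theorem sampleMean_mem_Icc (henv : IsEnvironment Pr μ P X Q) (n : Fin N) (k : Fin K) (s : ℕ)
    (ω : Ω) : sampleMean X n k s ω ∈ Set.Icc (0 : ℝ) 1 := by
  unfold sampleMean
  constructor
  · exact div_nonneg (sum_nonneg fun i hi ↦ (henv.reward_mem_Icc n k (mem_Icc.1 hi).1 ω).1)
      (Nat.cast_nonneg _)
  · refine div_le_one_of_le₀ ?_ (Nat.cast_nonneg _)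
    calc ∑ i ∈ Icc 1 s, X n k i ω ≤ ∑ i ∈ Icc 1 s, 1 :=
        sum_le_sum fun i hi ↦ (henv.reward_mem_Icc n k (mem_Icc.1 hi).1 ω).2
      _ = s := by simp

theorem measurableSet_indexLow (henv : IsEnvironment Pr μ P X Q) (ν : ℝ) (n : Fin N) (k : Fin K)
    (t : ℕ) : MeasurableSet (indexLow X ν n k t) := by
  have : indexLow X ν n k t = ⋃ s : ℕ, ⋃ _ : 1 ≤ s, {ω | sampleMean X n k s ω < ν} ∩
      {ω | Real.log (explore t) / s < klReal (sampleMean X n k s ω) ν} := by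
    ext ω
    simp only [indexLow, Set.mem_ofPred_eq, Set.mem_iUnion, Set.mem_inter_iff, exists_prop]
  rw [this]
  refine MeasurableSet.iUnion fun s ↦ MeasurableSet.iUnion fun _ ↦ ?_
  have hm := henv.measurable_sampleMean n k s
  refine (measurableSet_lt hm measurable_const).inter (measurableSet_lt measurable_const ?_)
  unfold klReal
  fun_prop

theorem measurableSet_meanHigh (henv : IsEnvironment Pr μ P X Q) (x : ℝ) (n : Fin N) (k : Fin K)
    (m : ℕ) : MeasurableSet (meanHigh X x n k m) := by
  have : meanHigh X x n k m = ⋃ s : ℕ, ⋃ _ : m ≤ s, ⋃ _ : 1 ≤ s,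
      {ω | x < sampleMean X n k s ω} := by
    ext ω
    simp only [meanHigh, Set.mem_ofPred_eq, Set.mem_iUnion, exists_prop]
  rw [this]
  exact MeasurableSet.iUnion fun s ↦ MeasurableSet.iUnion fun _ ↦ MeasurableSet.iUnion fun _ ↦
    measurableSet_lt measurable_const (henv.measurable_sampleMean n k s)

theorem measurableSet_noContact (henv : IsEnvironment Pr μ P X Q) (n q : Fin N) (a h : ℕ) :
    MeasurableSet (noContact Q n q a h) := by
  have : noContact Q n q a h = ⋂ j : ℕ, ⋂ _ : a < j, ⋂ _ : j ≤ a + h, {ω | Q n j ω = q}ᶜ := by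
    ext ω; simp [noContact]
  rw [this]
  exact MeasurableSet.iInter fun j ↦ MeasurableSet.iInter fun h1 ↦ MeasurableSet.iInter fun _ ↦
    (measurableSet_eq_fun (henv.measurable_sender n j (by omega)) measurable_const).compl

variable [IsProbabilityMeasure Pr]

theorem integrable_reward (henv : IsEnvironment Pr μ P X Q) (n : Fin N) (k : Fin K) {s : ℕ}
    (hs : 1 ≤ s) : Integrable (X n k s) Pr :=
  Integrable.of_mem_Icc 0 1 (henv.measurable_reward n k s hs).aemeasurable
    (Eventually.of_forall fun ω ↦ henv.reward_mem_Icc n k hs ω)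

/-- Hoeffding's inequality for both signs, with variance proxy 1/4 for variables in [0, 1]. The
index set is arbitrary because both initial and final segments of the reward sequence are needed for
the regret. -/
theorem measureReal_deviation_le (henv : IsEnvironment Pr μ P X Q) (n : Fin N) (k : Fin K)
    (F : Finset ℕ) {η : ℝ} (hη : 0 ≤ η) :
    Pr.real {ω | η * #F < |∑ i ∈ F, (X n k (i + 1) ω - μ k)|} ≤
      2 * Real.exp (-(2 * η ^ 2 * #F)) := by
  have hsub : ∀ i, HasSubgaussianMGF (fun ω ↦ X n k (i + 1) ω - μ k) ((‖(1 : ℝ) - 0‖₊ / 2) ^ 2)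
      Pr := by
    intro i
    have := hasSubgaussianMGF_of_mem_Icc (μ := Pr)
      (henv.measurable_reward n k (i + 1) (by omega)).aemeasurable
      (Eventually.of_forall fun ω ↦ henv.reward_mem_Icc n k (show 1 ≤ i + 1 by omega) ω)
    rwa [henv.integral_reward n k (by omega)] at this
  have hind : iIndepFun (fun (i : ℕ) ω ↦ X n k (i + 1) ω - μ k) Pr :=
    (henv.iIndepFun_reward n k).comp (fun _ x ↦ x - μ k) fun _ ↦ by fun_prop
  have hind' : iIndepFun (fun (i : ℕ) ω ↦ -(X n k (i + 1) ω - μ k)) Pr :=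
    hind.comp (fun _ x ↦ -x) fun _ ↦ by fun_prop
  have hη' : 0 ≤ η * #F := by positivity
  have h1 := HasSubgaussianMGF.measure_sum_ge_le_of_iIndepFun hind (s := F)
    (fun i _ ↦ hsub i) hη'
  have h2 := HasSubgaussianMGF.measure_sum_ge_le_of_iIndepFun hind' (s := F)
    (fun i _ ↦ (hsub i).neg) hη'
  have hexp : Real.exp (-(η * #F) ^ 2 / (2 * (∑ i ∈ F, ((‖(1 : ℝ) - 0‖₊ / 2) ^ 2 : NNReal) : NNReal)))
      = Real.exp (-(2 * η ^ 2 * #F)) := by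
    congr 1
    simp only [sub_zero, nnnorm_one, sum_const, nsmul_eq_mul]
    push_cast
    rcases eq_or_ne (#F : ℝ) 0 with h | h
    · simp [h]
    · field_simp
  rw [hexp] at h1 h2
  have hle : Pr.real {ω | η * #F < |∑ i ∈ F, (X n k (i + 1) ω - μ k)|} ≤
      Pr.real ({ω | η * #F ≤ ∑ i ∈ F, (X n k (i + 1) ω - μ k)} ∪
        {ω | η * #F ≤ ∑ i ∈ F, -(X n k (i + 1) ω - μ k)}) := by
    refine measureReal_mono ?_
    intro ω hω
    simp only [Set.mem_ofPred_eq, Set.mem_union, sum_neg_distrib] at hω ⊢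
    rcases lt_abs.1 hω with h | h
    · exact Or.inl h.le
    · exact Or.inr h.le
  have := measureReal_union_le (μ := Pr) {ω | η * #F ≤ ∑ i ∈ F, (X n k (i + 1) ω - μ k)}
        {ω | η * #F ≤ ∑ i ∈ F, -(X n k (i + 1) ω - μ k)}
  linarith

/-- Markov's inequality for the likelihood ratio of Bernoulli(c/S) against Bernoulli(q): on the
event this product is exactly exp(S KL(c/S, q)). Comparing with `q` instead of `μ k` keeps the
divergence finite when `μ k = 1`. -/
theorem measureReal_sum_eq_le (henv : IsEnvironment Pr μ P X Q) (n : Fin N) (k : Fin K)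
    {S c : ℕ} {q : ℝ} (hS : 1 ≤ S) (hq0 : 0 < q) (hq1 : q < 1) (hqμ : q ≤ μ k)
    (hc : (c : ℝ) / S ≤ q) :
    Pr.real {ω | ∑ i ∈ range S, X n k (i + 1) ω = c} ≤
      Real.exp (-(S * klReal (c / S) q)) := by
  have hS0 : (0 : ℝ) < S := by exact_mod_cast hS
  have hcS : c ≤ S := by
    have : (c : ℝ) / S ≤ 1 := by linarith
    rw [div_le_one hS0] at this
    exact_mod_cast this
  set p : ℝ := c / S with hp
  have hp0 : 0 ≤ p := by positivity
  have hp1 : p < 1 := by linarith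
  set a : ℝ := p / q
  set b : ℝ := (1 - p) / (1 - q)
  have ha : 0 ≤ a := by positivity
  have hb : 0 < b := div_pos (by linarith) (by linarith)
  set g : ℝ → ℝ := fun x ↦ a * x + b * (1 - x) with hg
  have hgi : ∀ i : ℕ, ∫ ω, g (X n k (i + 1) ω) ∂Pr = a * μ k + b * (1 - μ k) := by
    intro i
    have hI := henv.integrable_reward n k (show 1 ≤ i + 1 by omega)
    simp only [hg]
    have hI' : Integrable (fun ω ↦ 1 - X n k (i + 1) ω) Pr := (integrable_const 1).sub hI
    rw [integral_add (hI.const_mul a) (hI'.const_mul b),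
      integral_const_mul, integral_const_mul, integral_sub (integrable_const 1) hI,
      henv.integral_reward n k (by omega)]
    simp
  -- A factor has mean 1 under Bernoulli(q). Since a ≤ 1 ≤ b, raising the success probability from
  -- `q` to `μ k` can only lower that mean.
  have hle1 : a * μ k + b * (1 - μ k) ≤ 1 := by
    have e : a * q + b * (1 - q) = 1 := by
      have : (1 : ℝ) - q ≠ 0 := by linarith
      simp only [a, b]; field_simp; ring
    have hab : a ≤ b := by
      calc a ≤ 1 := (div_le_one hq0).2 hc
        _ ≤ b := (one_le_div (by linarith)).2 (by linarith)
    nlinarith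
  have hge0 : 0 ≤ a * μ k + b * (1 - μ k) :=
    add_nonneg (mul_nonneg ha (μ k).2.1) (mul_nonneg hb.le (by linarith [(μ k).2.2]))
  have hEZ : ∫ ω, ∏ i : Fin S, g (X n k (i + 1) ω) ∂Pr ≤ 1 := by
    have hind : iIndepFun (fun i : Fin S ↦ X n k (i + 1)) Pr :=
      (henv.iIndepFun_reward n k).precomp (g := fun i : Fin S ↦ (i : ℕ)) Fin.val_injective
    have := hind.integral_fun_prod_comp (f := fun _ ↦ g)
      (fun i ↦ (henv.measurable_reward n k _ (by omega)).aemeasurable)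
      (fun i ↦ Measurable.aestronglyMeasurable (by fun_prop))
    rw [this, prod_congr rfl fun (i : Fin S) _ ↦ hgi i]
    simp only [prod_const]
    exact pow_le_one₀ hge0 hle1
  have hval : ∀ ω, ∑ i ∈ range S, X n k (i + 1) ω = c →
      Real.exp (S * klReal p q) ≤ ∏ i : Fin S, g (X n k (i + 1) ω) := by
    intro ω hω
    rw [← prod_range (fun i ↦ g (X n k (i + 1) ω))]
    have h1 : ∀ i ∈ range S, g (X n k (i + 1) ω) = if X n k (i + 1) ω = 1 then a else b := by
      intro i _
      rcases henv.reward_mem n k (i + 1) (by omega) ω with h | h <;> simp [hg, h]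
    have h2 : ∀ i ∈ range S, X n k (i + 1) ω = if X n k (i + 1) ω = 1 then 1 else 0 := by
      intro i _
      rcases henv.reward_mem n k (i + 1) (by omega) ω with h | h <;> simp [h]
    have h3 : #{i ∈ range S | X n k (i + 1) ω = 1} = c := by
      rw [sum_congr rfl h2, sum_boole] at hω
      exact_mod_cast hω
    have h4 : #{i ∈ range S | ¬ X n k (i + 1) ω = 1} = S - c := by
      have := card_filter_add_card_filter_not (s := range S) (fun i ↦ X n k (i + 1) ω = 1)
      rw [card_range] at this
      omega
    rw [prod_congr rfl h1, prod_ite, prod_const, prod_const, h3, h4]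
    have e1 : S * klReal p q = c * Real.log a + (S - c : ℕ) * Real.log b := by
      rw [Nat.cast_sub hcS]
      unfold klReal
      have : (S : ℝ) * p = c := by rw [hp]; field_simp
      calc (S : ℝ) * (p * Real.log (p / q) + (1 - p) * Real.log ((1 - p) / (1 - q)))
          = (S * p) * Real.log a + (S - S * p) * Real.log b := by simp only [a, b]; ring
        _ = _ := by rw [this]
    rw [e1, Real.exp_add]
    have e2 : Real.exp ((S - c : ℕ) * Real.log b) = b ^ (S - c) := by
      rw [← Real.log_pow, Real.exp_log (by positivity)]
    have e3 : Real.exp (c * Real.log a) = a ^ c := by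
      -- For `c = 0` the ratio `a` is 0, but its logarithm is multiplied by 0 and both sides are 1.
      rcases Nat.eq_zero_or_pos c with h | h
      · simp [h]
      · have : 0 < a := div_pos (div_pos (by exact_mod_cast h) hS0) hq0
        rw [← Real.log_pow, Real.exp_log (by positivity)]
    rw [e2, e3]
  have hint : Integrable (fun ω ↦ ∏ i : Fin S, g (X n k (i + 1) ω)) Pr := by
    refine Integrable.of_bound (C := ∏ i : Fin S, (a + b)) ?_ (Eventually.of_forall fun ω ↦ ?_)
    · exact (Finset.measurable_fun_prod _ fun i _ ↦ (show Measurable g by fun_prop).comp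
        (henv.measurable_reward n k _ (by omega))).aestronglyMeasurable
    · rw [norm_prod]
      refine prod_le_prod (fun _ _ ↦ norm_nonneg _) fun i _ ↦ ?_
      rcases henv.reward_mem n k (i + 1) (by omega) ω with h | h <;>
        simp [hg, h, abs_of_nonneg ha, abs_of_pos hb, hb.le, ha]
  have hnn : ∀ ω, 0 ≤ ∏ i : Fin S, g (X n k (i + 1) ω) := by
    intro ω
    refine prod_nonneg fun i _ ↦ ?_
    rcases henv.reward_mem n k (i + 1) (by omega) ω with h | h <;> simp [hg, h, hb.le, ha]
  have hmarkov := mul_meas_ge_le_integral_of_nonneg (Eventually.of_forall hnn) hint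
    (Real.exp (S * klReal p q))
  have hmono : Pr.real {ω | ∑ i ∈ range S, X n k (i + 1) ω = c} ≤
      Pr.real {ω | Real.exp (S * klReal p q) ≤ ∏ i : Fin S, g (X n k (i + 1) ω)} :=
    measureReal_mono fun ω hω ↦ hval ω hω
  rw [Real.exp_neg, ← one_div, le_div_iff₀' (Real.exp_pos _)]
  calc _ ≤ _ := mul_le_mul_of_nonneg_left hmono (Real.exp_pos _).le
    _ ≤ _ := hmarkov
    _ ≤ 1 := hEZ

theorem prob_sender_le_one (henv : IsEnvironment Pr μ P X Q) (n q : Fin N) : P n q ≤ 1 := by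
  have h1 : Pr {ω | Q n 1 ω = q} ≤ 1 := prob_le_one
  rw [henv.sender_law n 1 le_rfl q] at h1
  exact ENNReal.ofReal_le_one.1 h1

theorem measureReal_noContact_le (henv : IsEnvironment Pr μ P X Q) (n q : Fin N) (a h : ℕ)
    (hP : 0 ≤ P n q) :
    Pr.real (noContact Q n q a h) ≤ (1 - P n q) ^ h := by
  have hind : iIndepFun (fun i : ℕ ↦ Q n (i + 1)) Pr :=
    henv.indep_sender.precomp (g := fun i : ℕ ↦ (n, i)) fun i j h ↦ by simpa using h
  have hset : noContact Q n q a h = ⋂ i ∈ Ico a (a + h), Q n (i + 1) ⁻¹' {q}ᶜ := by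
    ext ω
    simp only [noContact, Set.mem_ofPred_eq, mem_Ico, Set.mem_iInter, Set.mem_preimage,
      Set.mem_compl_iff, Set.mem_singleton_iff]
    constructor
    · intro H i hi
      exact H (i + 1) (by omega) (by omega)
    · intro H j h1 h2
      have := H (j - 1) (by omega)
      rwa [Nat.sub_add_cancel (by omega)] at this
  have hone : ∀ i : ℕ, Pr (Q n (i + 1) ⁻¹' {q}ᶜ) = ENNReal.ofReal (1 - P n q) := by
    intro i
    rw [Set.preimage_compl, prob_compl_eq_one_sub (henv.measurable_sender n (i + 1) (by omega)
      (measurableSet_singleton q))]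
    have := henv.sender_law n (i + 1) (by omega) q
    change Pr (Q n (i + 1) ⁻¹' {q}) = _ at this
    rw [this, ENNReal.ofReal_sub 1 hP, ENNReal.ofReal_one]
  have hP1 := henv.prob_sender_le_one n q
  have := hind.measure_inter_preimage_eq_mul (Ico a (a + h)) (sets := fun _ ↦ {q}ᶜ)
    (fun _ _ ↦ (measurableSet_singleton q).compl)
  rw [hset, measureReal_def, this, prod_congr rfl fun i _ ↦ hone i]
  rw [prod_const, Nat.card_Ico, Nat.add_sub_cancel_left, ENNReal.toReal_pow,
    ENNReal.toReal_ofReal (by linarith)]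

theorem measureReal_lt_sampleMean_le (henv : IsEnvironment Pr μ P X Q) (n : Fin N) (k : Fin K) {x : ℝ}
    {s : ℕ} (hx : μ k < x) (hs : 1 ≤ s) :
    Pr.real {ω | x < sampleMean X n k s ω} ≤ 2 * Real.exp (-(2 * (x - μ k) ^ 2 * s)) := by
  have h := henv.measureReal_deviation_le n k (range s) (sub_nonneg.2 hx.le)
  rw [card_range] at h
  refine (measureReal_mono ?_).trans h
  intro ω hω
  have hs0 : (0 : ℝ) < s := by exact_mod_cast hs
  simp only [Set.mem_ofPred_eq, sampleMean, lt_div_iff₀ hs0, sum_Icc_one_eq_sum_range] at hω ⊢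
  refine lt_of_lt_of_le ?_ (le_abs_self _)
  simp only [sum_sub_distrib, sum_const, card_range, nsmul_eq_mul]
  linarith

end IsEnvironment

end AOGB

/-! ### Union bounds over all sample sizes -/

namespace AOGB

theorem measureReal_iUnion_le_tsum {Ω : Type*} [MeasurableSpace Ω] {Pr : Measure Ω}
    [IsProbabilityMeasure Pr] {E : ℕ → Set Ω} {b : ℕ → ℝ} (hb : Summable b)
    (hE : ∀ s, Pr.real (E s) ≤ b s) : Pr.real (⋃ s, E s) ≤ ∑' s, b s := by
  have hb0 : ∀ s, 0 ≤ b s := fun s ↦ measureReal_nonneg.trans (hE s)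
  have h1 : Pr (⋃ s, E s) ≤ ENNReal.ofReal (∑' s, b s) := by
    refine (measure_iUnion_le E).trans ?_
    rw [ENNReal.ofReal_tsum_of_nonneg hb0 hb]
    refine ENNReal.tsum_le_tsum fun s ↦ ?_
    rw [← ofReal_measureReal]
    exact ENNReal.ofReal_le_ofReal (hE s)
  exact ENNReal.toReal_le_of_le_ofReal (tsum_nonneg hb0) h1

theorem summable_exp_neg_mul_nat {c : ℝ} (hc : 0 < c) :
    Summable fun s : ℕ ↦ Real.exp (-(c * s)) := by
  have := Real.summable_exp_nat_mul_iff.2 (neg_lt_zero.2 hc)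
  refine this.congr fun s ↦ ?_
  congr 1; ring

theorem summable_mul_exp_neg_mul_nat {c : ℝ} (hc : 0 < c) :
    Summable fun s : ℕ ↦ (s : ℝ) * Real.exp (-(c * s)) := by
  have h : ‖Real.exp (-c)‖ < 1 := by
    rw [Real.norm_of_nonneg (Real.exp_pos _).le, Real.exp_lt_one_iff]; linarith
  have := summable_pow_mul_geometric_of_norm_lt_one 1 h
  refine this.congr fun s ↦ ?_
  rw [pow_one, ← Real.exp_nat_mul]
  congr 2; ring

namespace IsEnvironment

variable {Ω : Type*} [MeasurableSpace Ω] {Pr : Measure Ω} [IsProbabilityMeasure Pr]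
  {N K : ℕ} {μ : Fin K → unitInterval} {P : Matrix (Fin N) (Fin N) ℝ}
  {X : Fin N → Fin K → ℕ → Ω → ℝ} {Q : Fin N → ℕ → Ω → Fin N}

/-- The gap between `ν` and `q` pays for the union over sample sizes: by the three-point inequality
KL(p, q) ≥ KL(p, ν) + KL(ν, q), each pair (s, c) costs at most exp(-s KL(ν, q)) / f(t). There are s
+ 1 values of the sum c, and the series in s converges. -/
theorem measureReal_indexLow_le (henv : IsEnvironment Pr μ P X Q) (n : Fin N) (k : Fin K)
    {ν q : ℝ} (hν : 0 < ν) (hνq : ν < q) (hq1 : q < 1) (hqμ : q ≤ μ k) (t : ℕ) :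
    Pr.real (indexLow X ν n k t) ≤
      (∑' s : ℕ, ((s : ℝ) + 1) * Real.exp (-(klReal ν q * s))) / explore t := by
  have hδ : 0 < klReal ν q := klReal_pos hν hνq hq1
  have hf : 0 < explore t := by linarith [one_le_explore t]
  set E : ℕ → ℕ → Set Ω := fun s c ↦ {ω | 1 ≤ s ∧ (c : ℝ) / s < ν ∧
    Real.log (explore t) / s < klReal (c / s) ν ∧ ∑ i ∈ range s, X n k (i + 1) ω = c} with hEdef
  have hE : ∀ s c, Pr.real (E s c) ≤ Real.exp (-(klReal ν q * s)) / explore t := by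
    intro s c
    by_cases h : 1 ≤ s ∧ (c : ℝ) / s < ν ∧ Real.log (explore t) / s < klReal (c / s) ν
    · obtain ⟨h1, h2, h3⟩ := h
      have hs0 : (0 : ℝ) < s := by exact_mod_cast h1
      have hb := henv.measureReal_sum_eq_le n k h1 (hν.trans hνq) hq1 hqμ (h2.le.trans hνq.le)
      refine (measureReal_mono fun ω hω ↦ hω.2.2.2).trans (hb.trans ?_)
      have h4 := klReal_add_le hν h2.le hνq.le hq1
      rw [div_lt_iff₀ hs0] at h3
      have : Real.exp (-(klReal ν q * s)) / explore t =
          Real.exp (-(klReal ν q * s) - Real.log (explore t)) := by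
        rw [Real.exp_sub, Real.exp_log hf]
      rw [this]
      apply Real.exp_le_exp.2
      nlinarith
    · have : E s c = ∅ := by
        ext ω
        simp only [hEdef, Set.mem_ofPred_eq, Set.mem_empty_iff_false, iff_false]
        tauto
      rw [this, measureReal_empty]
      positivity
  have hsub : indexLow X ν n k t ⊆ ⋃ s, ⋃ c ∈ range (s + 1), E s c := by
    rintro ω ⟨s, hs, h1, h2⟩
    have hsum : ∃ c ∈ range (s + 1), ∑ i ∈ range s, X n k (i + 1) ω = c := by
      refine ⟨#{i ∈ range s | X n k (i + 1) ω = 1}, ?_, ?_⟩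
      · have := card_filter_le (range s) fun i ↦ X n k (i + 1) ω = 1
        rw [card_range] at this
        exact mem_range.2 (by omega)
      · rw [← sum_boole]
        refine sum_congr rfl fun i _ ↦ ?_
        rcases henv.reward_mem n k (i + 1) (by omega) ω with h | h <;> simp [h]
    obtain ⟨c, hc, hsum⟩ := hsum
    have hm : sampleMean X n k s ω = c / s := by
      rw [sampleMean, sum_Icc_one_eq_sum_range, hsum]
    rw [hm] at h1 h2
    exact Set.mem_iUnion.2 ⟨s, Set.mem_iUnion₂.2 ⟨c, hc, hs, h1, h2, hsum⟩⟩
  refine (measureReal_mono hsub).trans ?_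
  rw [← tsum_div_const]
  refine measureReal_iUnion_le_tsum ?_ fun s ↦ ?_
  · refine Summable.div_const ?_ _
    refine ((summable_mul_exp_neg_mul_nat hδ).add (summable_exp_neg_mul_nat hδ)).congr
      fun s ↦ ?_
    ring
  · refine (measureReal_biUnion_finset_le _ _).trans ?_
    refine (sum_le_sum fun c _ ↦ hE s c).trans ?_
    rw [sum_const, card_range, nsmul_eq_mul]
    push_cast
    exact (mul_div_assoc _ _ _).ge

theorem measureReal_meanHigh_le (henv : IsEnvironment Pr μ P X Q) (n : Fin N) (k : Fin K)
    {x : ℝ} (hx : μ k < x) (m : ℕ) :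
    Pr.real (meanHigh X x n k m) ≤
      (∑' s : ℕ, 2 * Real.exp (-(2 * (x - μ k) ^ 2 * s))) *
        Real.exp (-(2 * (x - μ k) ^ 2 * m)) := by
  have hc : 0 < 2 * (x - μ k) ^ 2 := by
    have : 0 < x - μ k := sub_pos.2 hx
    positivity
  have hsub : meanHigh X x n k m ⊆ ⋃ s : ℕ, {ω | 1 ≤ m + s ∧ x < sampleMean X n k (m + s) ω} := by
    rintro ω ⟨s, h1, h2, h3⟩
    refine Set.mem_iUnion.2 ⟨s - m, ?_⟩
    rw [Set.mem_ofPred_eq, Nat.add_sub_cancel' h1]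
    exact ⟨h2, h3⟩
  refine (measureReal_mono hsub).trans ?_
  rw [← tsum_mul_right]
  refine measureReal_iUnion_le_tsum ?_ fun s ↦ ?_
  · exact ((summable_exp_neg_mul_nat hc).mul_left 2).mul_right _
  · by_cases h : 1 ≤ m + s
    · refine (measureReal_mono fun ω hω ↦ hω.2).trans
        ((henv.measureReal_lt_sampleMean_le n k hx h).trans_eq ?_)
      rw [mul_assoc 2 (Real.exp _) (Real.exp _), ← Real.exp_add]
      push_cast
      congr 2; ring
    · have : {ω | 1 ≤ m + s ∧ x < sampleMean X n k (m + s) ω} = ∅ := by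
        ext ω; simp [h]
      rw [this, measureReal_empty]
      positivity

end IsEnvironment

end AOGB

/-! ### Play counts and indices on a fixed outcome -/

namespace AOGB

section Counting

variable {Ω : Type*} {N K : ℕ} (I : Fin N → ℕ → Ω → Fin K) (n : Fin N) (k : Fin K) (ω : Ω)

theorem playCount_eq_add {a b : ℕ} (hab : a ≤ b) :
    playCount I n k b ω = playCount I n k a ω + #{s ∈ Ioc a b | I n s ω = k} := by
  unfold playCount
  rw [← card_union_of_disjoint, ← filter_union]
  · congr 2
    ext s; simp only [mem_union, mem_Icc, mem_Ioc]; omega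
  · rw [disjoint_left]
    intro s h1 h2
    simp only [mem_filter, mem_Icc, mem_Ioc] at h1 h2
    omega

theorem playCount_le (t : ℕ) : playCount I n k t ω ≤ t := by
  unfold playCount
  exact (card_filter_le _ _).trans (by simp)

theorem playCount_lt_of_lt {s t : ℕ} (hs : 1 ≤ s) (hst : s < t) (hI : I n s ω = k) :
    playCount I n k (s - 1) ω < playCount I n k (t - 1) ω := by
  have h1 := playCount_eq_add I n k ω (show s - 1 ≤ t - 1 by omega)
  have h2 : 0 < #{r ∈ Ioc (s - 1) (t - 1) | I n r ω = k} :=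
    card_pos.2 ⟨s, by simp only [mem_filter, mem_Ioc]; exact ⟨by omega, hI⟩⟩
  omega

theorem sum_card_filter_play (W : Finset ℕ) : ∑ k, #{s ∈ W | I n s ω = k} = #W :=
  (card_eq_sum_card_fiberwise fun s _ ↦ mem_univ (I n s ω)).symm

theorem sum_playCount (t : ℕ) : ∑ k, playCount I n k t ω = t := by
  unfold playCount
  rw [sum_card_filter_play]; simp

/-- Rounds in which an arm is played have different values of its play count. -/
theorem card_plays_le {W G : Finset ℕ} (hW : ∀ t ∈ W, 1 ≤ t ∧ I n t ω = k)
    (hG : ∀ t ∈ W, playCount I n k (t - 1) ω ∈ G) : #W ≤ #G := by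
  refine card_le_card_of_injOn (fun t ↦ playCount I n k (t - 1) ω) hG ?_
  intro s hs t ht hst
  rcases lt_trichotomy s t with h | h | h
  · exact absurd hst (playCount_lt_of_lt I n k ω (hW s hs).1 h (hW s hs).2).ne
  · exact h
  · exact absurd hst (playCount_lt_of_lt I n k ω (hW t ht).1 h (hW t ht).2).ne'

/-- Play counts just before the rounds of `W` are distinct, so it suffices to count their possible
values: those up to l / d, and those at which the sample mean exceeds `x`. -/
theorem card_plays_le_of_bound {X : Fin N → Fin K → ℕ → Ω → ℝ} {W : Finset ℕ} {T : ℕ}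
    {d l x : ℝ} (hd : 0 < d) (hl : 0 ≤ l)
    (hW : ∀ t ∈ W, 1 ≤ t ∧ t ≤ T ∧ I n t ω = k)
    (hb : ∀ t ∈ W, (playCount I n k (t - 1) ω : ℝ) * d ≤ l ∨
      (1 ≤ playCount I n k (t - 1) ω ∧ x < sampleMean X n k (playCount I n k (t - 1) ω) ω)) :
    (#W : ℝ) ≤ l / d + 1 + #{v ∈ Icc 1 T | x < sampleMean X n k v ω} := by
  have h := card_plays_le I n k ω (W := W)
    (G := range (⌊l / d⌋₊ + 1) ∪ {v ∈ Icc 1 T | x < sampleMean X n k v ω})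
    (fun t ht ↦ ⟨(hW t ht).1, (hW t ht).2.2⟩) ?_
  · have h2 := h.trans (card_union_le _ _)
    rw [card_range] at h2
    have h3 : (⌊l / d⌋₊ : ℝ) ≤ l / d := Nat.floor_le (by positivity)
    have h4 : (#W : ℝ) ≤ (⌊l / d⌋₊ : ℝ) + 1 + #{v ∈ Icc 1 T | x < sampleMean X n k v ω} := by
      exact_mod_cast h2
    linarith
  · intro t ht
    rw [mem_union]
    rcases hb t ht with h | ⟨h1, h2⟩
    · left
      rw [mem_range, Nat.lt_succ_iff]
      exact Nat.le_floor ((le_div_iff₀ hd).2 h)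
    · right
      have h3 := playCount_le I n k ω (t - 1)
      have h4 := (hW t ht).2.1
      exact mem_filter.2 ⟨mem_Icc.2 ⟨h1, by omega⟩, h2⟩

end Counting

section Index

variable {Ω : Type*} {N K : ℕ} {X : Fin N → Fin K → ℕ → Ω → ℝ} {I : Fin N → ℕ → Ω → Fin K}
  {n : Fin N} {k : Fin K} {t : ℕ} {ω : Ω}

theorem indexLow_anti (X : Fin N → Fin K → ℕ → Ω → ℝ) (ν : ℝ) (n : Fin N) (k : Fin K) {s t : ℕ}
    (h : s ≤ t) : indexLow X ν n k t ⊆ indexLow X ν n k s := by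
  rintro ω ⟨v, h1, h2, h3⟩
  refine ⟨v, h1, h2, lt_of_le_of_lt ?_ h3⟩
  have := log_explore_mono h
  gcongr

/-- If the sample mean is below `ν`, then `ν` itself is admissible in the supremum off the event;
otherwise the sample mean is admissible, as its divergence from itself is 0. -/
theorem le_ucb_of_notMem_indexLow {ν : ℝ} (hν : 0 < ν) (hν1 : ν < 1)
    (hmean : ∀ s, sampleMean X n k s ω ∈ Set.Icc (0 : ℝ) 1)
    (h : ω ∉ indexLow X ν n k t) : (ν : EReal) ≤ ucb X I n k t ω := by
  unfold ucb
  simp only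
  split_ifs with hv
  · exact le_top
  rw [EReal.coe_le_coe_iff]
  set v := playCount I n k (t - 1) ω
  have hbdd : BddAbove {u : ℝ | u ∈ Set.Icc 0 1 ∧ klBer (sampleMean X n k v ω) u ≤
      ENNReal.ofReal (Real.log (explore t) / v)} := ⟨1, fun u hu ↦ hu.1.2⟩
  rcases lt_or_ge (sampleMean X n k v ω) ν with hm | hm
  · refine le_csSup hbdd ⟨⟨hν.le, hν1.le⟩, ?_⟩
    rw [klBer_eq_ofReal hν hν1]
    refine ENNReal.ofReal_le_ofReal ?_
    by_contra hcon
    exact h ⟨v, Nat.one_le_iff_ne_zero.2 hv, hm, not_le.1 hcon⟩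
  · refine hm.trans (le_csSup hbdd ⟨hmean v, ?_⟩)
    rw [klBer_self]
    exact zero_le

/-- An index of at least `ν'` yields an admissible u > ν; the strict gap avoids using that the
supremum is attained. If the sample mean is at most `x`, monotonicity in both arguments gives KL(x,
ν) ≤ KL(mean, u) ≤ log f(t) / v. -/
theorem playCount_le_of_le_ucb {ν ν' x d : ℝ} (hx : 0 < x) (hxν : x ≤ ν) (hνν' : ν < ν')
    (hd : d ≤ klReal x ν) (hmean : ∀ s, sampleMean X n k s ω ∈ Set.Icc (0 : ℝ) 1)
    (h : (ν' : EReal) ≤ ucb X I n k t ω) :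
    (playCount I n k (t - 1) ω : ℝ) * d ≤ Real.log (explore t) ∨
      (1 ≤ playCount I n k (t - 1) ω ∧ x < sampleMean X n k (playCount I n k (t - 1) ω) ω) := by
  unfold ucb at h
  simp only at h
  set v := playCount I n k (t - 1) ω
  rcases Nat.eq_zero_or_pos v with hv | hv
  · left
    rw [hv, Nat.cast_zero, zero_mul]
    exact log_explore_nonneg t
  by_cases hm : x < sampleMean X n k v ω
  · exact Or.inr ⟨hv, hm⟩
  left
  rw [if_neg hv.ne', EReal.coe_le_coe_iff] at h
  have hv0 : (0 : ℝ) < v := by exact_mod_cast hv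
  have hl : 0 ≤ Real.log (explore t) / v := div_nonneg (log_explore_nonneg t) hv0.le
  obtain ⟨u, ⟨hu1, hu2⟩, hνu⟩ := exists_lt_of_lt_csSup
    (by exact ⟨sampleMean X n k v ω, hmean v, by rw [klBer_self]; exact zero_le⟩)
    (hνν'.trans_le h)
  have hm' := not_lt.1 hm
  -- The sample mean is at most `x`, hence below 1, so its divergence from 1 is infinite.
  have hu_lt : u < 1 := by
    refine lt_of_le_of_ne hu1.2 ?_
    rintro rfl
    unfold klBer at hu2
    rw [if_pos (Or.inr ⟨rfl, by linarith⟩)] at hu2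
    exact ENNReal.ofReal_ne_top (top_le_iff.1 hu2)
  have hν0 : 0 < ν := hx.trans_le hxν
  rw [klBer_eq_ofReal (by linarith) hu_lt, ENNReal.ofReal_le_ofReal_iff hl] at hu2
  have h1 := klReal_mono_right hν0 (hm'.trans hxν) hνu.le hu_lt
  have h2 := klReal_anti_left (hmean v).1 hx hm' hxν (hνu.trans hu_lt)
  rw [le_div_iff₀ hv0] at hu2
  nlinarith

end Index

/-! ### Spread of the best arm and the pathwise bound on plays -/

/-- There is a walk of length `l` from `n` to `a` in the graph of positive entries. -/
def reachIn {N : ℕ} (P : Matrix (Fin N) (Fin N) ℝ) (a : Fin N) : ℕ → Fin N → Prop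
  | 0, n => n = a
  | l + 1, n => ∃ q, 0 < P n q ∧ reachIn P a l q

theorem exists_reachIn {N : ℕ} {P : Matrix (Fin N) (Fin N) ℝ}
    (hconn : @Quiver.IsStronglyConnected (Fin N) P.toQuiver) (a : Fin N) :
    ∃ L, ∀ n, ∃ l ≤ L, reachIn P a l n := by
  have h : ∀ n, ∃ l, reachIn P a l n := by
    intro n
    have hrt : Relation.ReflTransGen (fun i j ↦ 0 < P i j) n a := by
      let := P.toQuiver
      obtain ⟨p⟩ := hconn n a
      induction p with
      | nil => exact Relation.ReflTransGen.refl
      | cons _ e ih => exact ih.tail e.down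
    induction hrt using Relation.ReflTransGen.head_induction_on with
    | refl => exact ⟨0, rfl⟩
    | head hstep _ ih =>
      obtain ⟨l, hl⟩ := ih
      exact ⟨l + 1, _, hstep, hl⟩
  choose l hl using h
  exact ⟨univ.sup l, fun n ↦ ⟨l n, le_sup (mem_univ n), hl n⟩⟩

theorem exists_phase {A : ℕ → ℕ} (hA₀ : A 0 = 0) (hA : StrictMono A) {t : ℕ} (ht : 1 ≤ t) :
    ∃ j, 1 ≤ j ∧ A (j - 1) < t ∧ t ≤ A j ∧ j ≤ t := by
  have hex : ∃ j, t ≤ A j := ⟨t, hA.id_le t⟩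
  have h1 := Nat.find_spec hex
  have h2 : Nat.find hex ≤ t := Nat.find_min' hex (hA.id_le t)
  have h3 : 1 ≤ Nat.find hex := by
    by_contra hcon
    have : Nat.find hex = 0 := by omega
    rw [this, hA₀] at h1
    omega
  have h4 := Nat.find_min hex (m := Nat.find hex - 1) (by omega)
  exact ⟨Nat.find hex, h3, by omega, h1, h2⟩

/-- The exceptional event of phase `j`: one of the concentration or gossip events up to that phase
fails. -/
def badEvent {Ω : Type*} {N K : ℕ} (A : ℕ → ℕ) (P : Matrix (Fin N) (Fin N) ℝ)
    (X : Fin N → Fin K → ℕ → Ω → ℝ) (Q : Fin N → ℕ → Ω → Fin N) (star : Fin K) (ν : ℝ)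
    (x : Fin K → ℝ) (m : ℕ → ℕ) (L h : ℕ) : Set Ω :=
  (⋃ n, indexLow X ν n star (A h)) ∪
    (⋃ n, ⋃ k, ⋃ _ : k ≠ star, meanHigh X (x k) n k (m h)) ∪
    ⋃ n, ⋃ q, ⋃ _ : 0 < P n q, ⋃ l ∈ range L, noContact Q n q ((l + 1) * h) h

namespace IsRun

variable {Ω : Type*} {N K : ℕ} {A : ℕ → ℕ} {S₀ : Fin N → Finset (Fin K)}
  {X : Fin N → Fin K → ℕ → Ω → ℝ} {Q : Fin N → ℕ → Ω → Fin N} {I M : Fin N → ℕ → Ω → Fin K}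

theorem subset_activeSet (S₀ : Fin N → Finset (Fin K)) (M : Fin N → ℕ → Ω → Fin K)
    (Q : Fin N → ℕ → Ω → Fin N) (n : Fin N) (j : ℕ) (ω : Ω) :
    S₀ n ⊆ activeSet S₀ M Q n j ω := by
  rcases j with _ | _ | j
  · exact subset_rfl
  · exact subset_rfl
  · exact subset_union_left

theorem playCount_le_of_mem_activeSet (hrun : IsRun A S₀ X Q I M) {star : Fin K}
    {ν ν' x d : ℝ} (hx : 0 < x) (hxν : x ≤ ν) (hνν' : ν < ν') (hν'1 : ν' < 1)
    (hd : d ≤ klReal x ν) {ω : Ω} {n : Fin N}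
    (hmean : ∀ k s, sampleMean X n k s ω ∈ Set.Icc (0 : ℝ) 1)
    {j t : ℕ} (hj : 1 ≤ j) (ht : A (j - 1) < t) (ht' : t ≤ A j)
    (hact : star ∈ activeSet S₀ M Q n j ω) (hlow : ω ∉ indexLow X ν' n star t) :
    (playCount I n (I n t ω) (t - 1) ω : ℝ) * d ≤ Real.log (explore t) ∨
      (1 ≤ playCount I n (I n t ω) (t - 1) ω ∧
        x < sampleMean X n (I n t ω) (playCount I n (I n t ω) (t - 1) ω) ω) :=
  playCount_le_of_le_ucb hx hxν hνν' hd (hmean _)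
    ((le_ucb_of_notMem_indexLow (by linarith) hν'1 (hmean star) hlow).trans
      (hrun.play_max n j t hj ht ht' ω star hact))

/-- Pigeonhole: each other arm gets at most m + log f(A_j) / d₀ + 1 rounds of the phase. If one of
them were most played, the best arm would obey the same bound, and K such counts could not fill the
phase. -/
theorem mostPlayed_eq (hrun : IsRun A S₀ X Q I M) (hA : StrictMono A) {star : Fin K}
    {ν ν' d₀ : ℝ} {x d : Fin K → ℝ} (hx : ∀ k, k ≠ star → 0 < x k ∧ x k ≤ ν) (hνν' : ν < ν')
    (hν'1 : ν' < 1) (hd₀ : 0 < d₀) (hd : ∀ k, k ≠ star → d₀ ≤ d k ∧ d k ≤ klReal (x k) ν)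
    {ω : Ω} {n : Fin N}
    (hmean : ∀ k s, sampleMean X n k s ω ∈ Set.Icc (0 : ℝ) 1) {j m : ℕ} (hj : 1 ≤ j)
    (hact : star ∈ activeSet S₀ M Q n j ω)
    (hlow : ω ∉ indexLow X ν' n star (A (j - 1)))
    (hhigh : ∀ k, k ≠ star → ω ∉ meanHigh X (x k) n k m)
    (hlen : K * (m + Real.log (explore (A j)) / d₀ + 2) < (A j : ℝ) - A (j - 1)) :
    M n j ω = star := by
  by_contra hM
  have hAj : A (j - 1) ≤ A j := hA.monotone (by omega)
  set c : Fin K → ℕ := fun k ↦ #{s ∈ Ioc (A (j - 1)) (A j) | I n s ω = k} with hc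
  have hbound : ∀ k, k ≠ star → (c k : ℝ) ≤ m + Real.log (explore (A j)) / d₀ + 1 := by
    intro k hk
    have hdk : 0 < d k := hd₀.trans_le (hd k hk).1
    have h := card_plays_le_of_bound I n k ω (X := X)
      (W := {s ∈ Ioc (A (j - 1)) (A j) | I n s ω = k}) (T := A j)
      (x := x k) hdk (log_explore_nonneg (A j)) ?_ ?_
    · have h2 : #{v ∈ Icc 1 (A j) | x k < sampleMean X n k v ω} ≤ m := by
        rw [← card_range m]
        refine card_le_card fun v hv ↦ ?_
        rw [mem_filter, mem_Icc] at hv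
        rw [mem_range]
        by_contra hvm
        exact hhigh k hk ⟨v, not_lt.1 hvm, hv.1.1, hv.2⟩
      have h2' : (#{v ∈ Icc 1 (A j) | x k < sampleMean X n k v ω} : ℝ) ≤ m := by exact_mod_cast h2
      have h3 : Real.log (explore (A j)) / d k ≤ Real.log (explore (A j)) / d₀ :=
        div_le_div_of_nonneg_left (log_explore_nonneg _) hd₀ (hd k hk).1
      linarith
    · intro t ht
      simp only [mem_filter, mem_Ioc] at ht
      exact ⟨by omega, ht.1.2, ht.2⟩
    · intro t ht
      simp only [mem_filter, mem_Ioc] at ht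
      have := hrun.playCount_le_of_mem_activeSet (hx k hk).1 (hx k hk).2 hνν' hν'1 (hd k hk).2
        hmean hj ht.1.1 ht.1.2 hact
        (fun hmem ↦ hlow (indexLow_anti X ν' n star ht.1.1.le hmem))
      rw [ht.2] at this
      exact this.imp_left fun h ↦ h.trans (log_explore_mono ht.1.2)
  have hmax : c star ≤ c (M n j ω) := by
    have h := hrun.mostPlayed_max n j hj ω star
    -- The differences in `mostPlayed_max` are truncated; writing the later count as a sum makes
    -- them the true counts within the phase.
    rwa [playCount_eq_add I n _ ω hAj, playCount_eq_add I n (M n j ω) ω hAj,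
      Nat.add_sub_cancel_left, Nat.add_sub_cancel_left] at h
  have hmax' : (c star : ℝ) ≤ c (M n j ω) := by exact_mod_cast hmax
  have hall : ∀ k, (c k : ℝ) ≤ m + Real.log (explore (A j)) / d₀ + 1 := by
    intro k
    by_cases hk : k = star
    · rw [hk]; exact hmax'.trans (hbound _ hM)
    · exact hbound k hk
  have hsum : ∑ k, (c k : ℝ) = (A j : ℝ) - A (j - 1) := by
    have := sum_card_filter_play I n ω (Ioc (A (j - 1)) (A j))
    rw [Nat.card_Ioc] at this
    rw [← Nat.cast_sub hAj, ← this]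
    push_cast
    rfl
  have h1 : ∑ k, (c k : ℝ) ≤ ∑ _k : Fin K, (m + Real.log (explore (A j)) / d₀ + 1) :=
    sum_le_sum fun k _ ↦ hall k
  rw [sum_const, card_univ, Fintype.card_fin, nsmul_eq_mul, hsum] at h1
  have hK : (0 : ℝ) ≤ K := Nat.cast_nonneg K
  nlinarith

/-- Outside the exceptional event, the best arm has spread to all agents by phase `j`. -/
theorem activeSet_of_notMem_badEvent (hrun : IsRun A S₀ X Q I M) (hA : StrictMono A)
    {P : Matrix (Fin N) (Fin N) ℝ} {star : Fin K} {a : Fin N} (ha : star ∈ S₀ a) {L : ℕ}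
    (hL : ∀ n, ∃ l ≤ L, reachIn P a l n)
    {ν ν' d₀ : ℝ} {x d : Fin K → ℝ} (hx : ∀ k, k ≠ star → 0 < x k ∧ x k ≤ ν) (hνν' : ν < ν')
    (hν'1 : ν' < 1) (hd₀ : 0 < d₀) (hd : ∀ k, k ≠ star → d₀ ≤ d k ∧ d k ≤ klReal (x k) ν)
    {ω : Ω} (hmean : ∀ n k s, sampleMean X n k s ω ∈ Set.Icc (0 : ℝ) 1) {m : ℕ → ℕ} {h j : ℕ}
    (hh : 1 ≤ h) (hj : (L + 3) * h ≤ j)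
    (hlen : ∀ i, h < i →
      K * (m h + Real.log (explore (A i)) / d₀ + 2) < (A i : ℝ) - A (i - 1))
    (hω : ω ∉ badEvent A P X Q star ν' x m L h) (n : Fin N) :
    star ∈ activeSet S₀ M Q n j ω ∧ activeSet S₀ M Q n j ω ⊆ insert star (S₀ n) ∧
      ω ∉ indexLow X ν' n star (A (j - 1)) := by
  simp only [badEvent, Set.mem_union, Set.mem_iUnion, not_or, not_exists] at hω
  obtain ⟨⟨hlow, hhigh⟩, hcontact⟩ := hω
  have hM : ∀ n i, h < i → star ∈ activeSet S₀ M Q n i ω → M n i ω = star := by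
    intro n i hi hact
    exact hrun.mostPlayed_eq hA hx hνν' hν'1 hd₀ hd (hmean n) (by omega) hact
      (fun hmem ↦ hlow n (indexLow_anti X ν' n star (hA.monotone (by omega)) hmem))
      (fun k hk ↦ hhigh n k hk) (hlen i hi)
  have hstep : ∀ n i, h < i → star ∈ activeSet S₀ M Q n i ω →
      star ∈ activeSet S₀ M Q n (i + 1) ω := by
    intro n i hi hact
    obtain ⟨i, rfl⟩ : ∃ i', i = i' + 1 := ⟨i - 1, by omega⟩
    have := hM n _ hi hact
    simp [activeSet, this]
  -- Once active, the best arm stays active, because an agent retains its own most played arm.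
  have hkeep : ∀ n i i', h < i → i ≤ i' → star ∈ activeSet S₀ M Q n i ω →
      star ∈ activeSet S₀ M Q n i' ω := by
    intro n i i' hi hii' hact
    induction i', hii' using Nat.le_induction with
    | base => exact hact
    | succ i' hii' ih => exact hstep n i' (by omega) ih
  -- Each edge of a walk to `a` uses its own window of `h` phases: the next agent on the walk is
  -- contacted there at least once and already recommends the best arm.
  have hspread : ∀ l ≤ L, ∀ n, reachIn P a l n → ∀ i, (l + 1) * h < i →
      star ∈ activeSet S₀ M Q n i ω := by
    intro l
    induction l with
    | zero =>
      rintro - n rfl i -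
      exact subset_activeSet S₀ M Q n i ω ha
    | succ l ih =>
      rintro hl n ⟨q, hq, hreach⟩ i hi
      have hc := hcontact n q hq l (mem_range.2 hl)
      simp only [noContact, Set.mem_ofPred_eq, not_forall, not_not] at hc
      obtain ⟨i', h1, h2, h3⟩ := hc
      have hhi' : h < i' := by nlinarith
      have hq' := hM q i' hhi' (ih (by omega) q hreach i' h1)
      refine hkeep n (i' + 1) i (by omega) (by nlinarith) ?_
      obtain ⟨i'', rfl⟩ : ∃ i'', i' = i'' + 1 := ⟨i' - 1, by omega⟩
      simp [activeSet, recommendation, h3, hq']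
  have hall : ∀ n i, (L + 1) * h < i → star ∈ activeSet S₀ M Q n i ω := by
    intro n i hi
    obtain ⟨l, hl, hr⟩ := hL n
    exact hspread l hl n hr i (lt_of_le_of_lt (Nat.mul_le_mul_right h (by omega)) hi)
  -- Two of the L + 3 blocks are slack: already in phase j - 1 the best arm must be active
  -- everywhere, so that all recommendations entering phase j equal it.
  have hj1 : (L + 1) * h + 2 ≤ j := by nlinarith
  have hhL : h ≤ (L + 1) * h := Nat.le_mul_of_pos_left h (by omega)
  refine ⟨hall n j (by omega), ?_, fun hmem ↦
    hlow n (indexLow_anti X ν' n star (hA.monotone (by omega)) hmem)⟩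
  obtain ⟨i, rfl⟩ : ∃ i, j = i + 2 := ⟨j - 2, by omega⟩
  have hMi : ∀ n, M n (i + 1) ω = star := fun n ↦
    hM n (i + 1) (by omega) (hall n (i + 1) (by omega))
  intro k hk
  simp only [activeSet, recommendation, hMi, mem_union, mem_insert, mem_singleton, or_self] at hk
  rw [mem_insert]
  exact hk.symm

/-- All rounds of exceptional phases are charged to the arm. In the other phases a nonsticky
suboptimal arm is not active at all, and a sticky one obeys the index bound. -/
theorem playCount_le_sum (hrun : IsRun A S₀ X Q I M) (hA₀ : A 0 = 0) (hA : StrictMono A)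
    {star k : Fin K} (hk : k ≠ star) {ν ν' x d : ℝ} (hx : 0 < x) (hxν : x ≤ ν) (hνν' : ν < ν')
    (hν'1 : ν' < 1) (hd0 : 0 < d) (hd : d ≤ klReal x ν) {ω : Ω} {n : Fin N}
    (hmean : ∀ k s, sampleMean X n k s ω ∈ Set.Icc (0 : ℝ) 1) {B : ℕ → Set Ω}
    (hB : ∀ j, 1 ≤ j → ω ∉ B j →
      star ∈ activeSet S₀ M Q n j ω ∧ activeSet S₀ M Q n j ω ⊆ insert star (S₀ n) ∧
      ω ∉ indexLow X ν' n star (A (j - 1))) (T : ℕ) :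
    (playCount I n k T ω : ℝ) ≤
      ∑ j ∈ Icc 1 T, ((A j : ℝ) - A (j - 1)) * (B j).indicator 1 ω +
      if k ∈ S₀ n then Real.log (explore T) / d + 1 +
        ∑ v ∈ Icc 1 T, {ω | x < sampleMean X n k v ω}.indicator 1 ω else 0 := by
  classical
  set W : Finset ℕ := {t ∈ Icc 1 T | I n t ω = k ∧
    ∃ j, 1 ≤ j ∧ A (j - 1) < t ∧ t ≤ A j ∧ ω ∉ B j} with hWdef
  have hsub : {t ∈ Icc 1 T | I n t ω = k} ⊆
      ({j ∈ Icc 1 T | ω ∈ B j}.biUnion fun j ↦ Ioc (A (j - 1)) (A j)) ∪ W := by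
    intro t ht
    rw [mem_filter, mem_Icc] at ht
    -- The bound j ≤ t keeps the phase in the range 1, …, T of the sum.
    obtain ⟨j, h1, h2, h3, h4⟩ := exists_phase hA₀ hA ht.1.1
    rw [mem_union]
    by_cases hj : ω ∈ B j
    · left
      exact mem_biUnion.2 ⟨j, mem_filter.2 ⟨mem_Icc.2 ⟨h1, by omega⟩, hj⟩, mem_Ioc.2 ⟨h2, h3⟩⟩
    · right
      exact mem_filter.2 ⟨mem_Icc.2 ht.1, ht.2, j, h1, h2, h3, hj⟩
  have hcard := (card_le_card hsub).trans (card_union_le _ _)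
  have h1 : ((#({j ∈ Icc 1 T | ω ∈ B j}.biUnion fun j ↦ Ioc (A (j - 1)) (A j)) : ℕ) : ℝ) ≤
      ∑ j ∈ Icc 1 T, ((A j : ℝ) - A (j - 1)) * (B j).indicator 1 ω := by
    have h := card_biUnion_le (s := {j ∈ Icc 1 T | ω ∈ B j})
      (t := fun j ↦ Ioc (A (j - 1)) (A j))
    calc _ ≤ ((∑ j ∈ Icc 1 T with ω ∈ B j, #(Ioc (A (j - 1)) (A j)) : ℕ) : ℝ) := by
          exact_mod_cast h
      _ = _ := by
        rw [sum_filter]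
        push_cast
        refine sum_congr rfl fun j _ ↦ ?_
        have : A (j - 1) ≤ A j := hA.monotone (by omega)
        by_cases hj : ω ∈ B j <;> simp [hj, Nat.cast_sub this]
  have h2 : (#W : ℝ) ≤ if k ∈ S₀ n then Real.log (explore T) / d + 1 +
        ∑ v ∈ Icc 1 T, {ω | x < sampleMean X n k v ω}.indicator 1 ω else 0 := by
    split_ifs with hkS
    · have h := card_plays_le_of_bound I n k ω (X := X) (W := W) (T := T) (x := x) hd0
        (log_explore_nonneg T) ?_ ?_
      · refine h.trans_eq ?_
        congr 1
        rw [card_filter]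
        push_cast
        refine sum_congr rfl fun v _ ↦ ?_
        by_cases hv : x < sampleMean X n k v ω <;> simp [hv]
      · intro t ht
        rw [hWdef, mem_filter, mem_Icc] at ht
        exact ⟨ht.1.1, ht.1.2, ht.2.1⟩
      · intro t ht
        rw [hWdef, mem_filter, mem_Icc] at ht
        obtain ⟨⟨-, htT⟩, hIt, j, hj, ht1, ht2, hBj⟩ := ht
        obtain ⟨hact, -, hlow⟩ := hB j hj hBj
        have := hrun.playCount_le_of_mem_activeSet hx hxν hνν' hν'1 hd hmean hj ht1 ht2 hact
          (fun hmem ↦ hlow (indexLow_anti X ν' n star ht1.le hmem))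
        rw [hIt] at this
        exact this.imp_left fun h ↦ h.trans (log_explore_mono htT)
    · have : W = ∅ := by
        rw [hWdef, filter_eq_empty_iff]
        rintro t - ⟨hIt, j, hj, ht1, ht2, hBj⟩
        have hmem := (hB j hj hBj).2.1 (hrun.play_mem n j t hj ht1 ht2 ω)
        rw [hIt, mem_insert] at hmem
        exact hmem.elim hk hkS
      rw [this]; simp
  have h3 : (playCount I n k T ω : ℝ) ≤
      (#({j ∈ Icc 1 T | ω ∈ B j}.biUnion fun j ↦ Ioc (A (j - 1)) (A j)) : ℕ) + (#W : ℝ) := by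
    exact_mod_cast hcard
  linarith

end IsRun

end AOGB

/-! ### Measurability of the run -/

namespace AOGB

theorem one_le_playCount_self {Ω : Type*} {N K : ℕ} {I : Fin N → ℕ → Ω → Fin K} {n : Fin N} {t : ℕ} (ht : 1 ≤ t) (ω : Ω) :
    1 ≤ playCount I n (I n t ω) t ω :=
  card_pos.2 ⟨t, mem_filter.2 ⟨mem_Icc.2 ⟨ht, le_rfl⟩, rfl⟩⟩

section Measurability

variable {Ω : Type*} [mΩ : MeasurableSpace Ω] {Pr : Measure Ω}
  {N K : ℕ} {μ : Fin K → unitInterval} {P : Matrix (Fin N) (Fin N) ℝ}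
  {X : Fin N → Fin K → ℕ → Ω → ℝ} {Q : Fin N → ℕ → Ω → Fin N}
  {A : ℕ → ℕ} {S₀ : Fin N → Finset (Fin K)} {I M : Fin N → ℕ → Ω → Fin K}

theorem measurable_playCount {n : Fin N} {t : ℕ} (hI : ∀ s, 1 ≤ s → s ≤ t → Measurable (I n s))
    (k : Fin K) : Measurable (playCount I n k t) := by
  have : playCount I n k t = fun ω ↦ ∑ s ∈ Icc 1 t, if I n s ω = k then 1 else 0 := by
    funext ω
    unfold playCount
    rw [card_filter]
  rw [this]
  refine Finset.measurable_fun_sum _ fun s hs ↦ ?_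
  rw [mem_Icc] at hs
  exact Measurable.ite (hI s hs.1 hs.2 (measurableSet_singleton k)) measurable_const
    measurable_const

theorem measurable_reward_round (henv : IsEnvironment Pr μ P X Q) {n : Fin N} {t : ℕ}
    (ht : 1 ≤ t) (hI : ∀ s, 1 ≤ s → s ≤ t → Measurable (I n s)) :
    Measurable (reward X I n t) := by
  -- Decomposing by arm and play number turns the random index into a finite sum. It starts at s =
  -- 1, since `X n k 0` need not be measurable.
  have : reward X I n t = fun ω ↦ ∑ k, ∑ s ∈ Icc 1 t,
      if I n t ω = k ∧ playCount I n k t ω = s then X n k s ω else 0 := by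
    funext ω
    rw [sum_eq_single (I n t ω), sum_eq_single (playCount I n (I n t ω) t ω)]
    · simp [reward]
    · intro s _ hs
      rw [if_neg]
      exact fun h ↦ hs h.2.symm
    · intro h
      exact absurd (mem_Icc.2 ⟨one_le_playCount_self ht ω, playCount_le I n _ ω t⟩) h
    · intro k _ hk
      refine sum_eq_zero fun s _ ↦ ?_
      rw [if_neg]
      exact fun h ↦ hk h.1.symm
    · intro h
      exact absurd (mem_univ _) h
  rw [this]
  refine Finset.measurable_fun_sum _ fun k _ ↦ Finset.measurable_fun_sum _ fun s hs ↦ ?_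
  rw [mem_Icc] at hs
  refine Measurable.ite ?_ (henv.measurable_reward n k s hs.1) measurable_const
  exact (hI t ht le_rfl (measurableSet_singleton k)).inter
    (measurable_playCount hI k (measurableSet_singleton s))

theorem history_le (henv : IsEnvironment Pr μ P X Q) {n : Fin N} {t j : ℕ}
    (hI : ∀ s, 1 ≤ s → s ≤ t → Measurable (I n s))
    (hR : ∀ i, 1 ≤ i → i ≤ j → Measurable (recommendation M Q n i)) :
    history X Q I M n t j ≤ mΩ := by
  refine sup_le (iSup₂_le fun s hs ↦ ?_) (iSup₂_le fun i hi ↦ ?_)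
  · rw [mem_Icc] at hs
    exact (measurable_reward_round henv hs.1
      fun r h1 h2 ↦ hI r h1 (h2.trans hs.2)).comap_le
  · rw [mem_Icc] at hi
    exact (hR i hi.1 hi.2).comap_le

/-- The history of one agent involves messages, hence choices of other agents; induction over
phases, and over rounds within a phase, resolves this dependence. -/
theorem IsRun.measurable_of_phase (hrun : IsRun A S₀ X Q I M) (henv : IsEnvironment Pr μ P X Q)
    (hA₀ : A 0 = 0) (j : ℕ) :
    (∀ n t, 1 ≤ t → t ≤ A j → Measurable (I n t)) ∧
      ∀ n i, 1 ≤ i → i ≤ j → Measurable (recommendation M Q n i) := by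
  induction j with
  | zero => exact ⟨fun n t h1 h2 ↦ by omega, fun n i h1 h2 ↦ by omega⟩
  | succ j ih =>
    obtain ⟨ihI, ihR⟩ := ih
    have hI : ∀ n t, 1 ≤ t → t ≤ A (j + 1) → Measurable (I n t) := by
      intro n t
      induction t using Nat.strong_induction_on with
      | _ t iht =>
        intro h1 h2
        rcases le_or_gt t (A j) with h | h
        · exact ihI n t h1 h
        · have := hrun.play_measurable n (j + 1) t (by omega) (by simpa using h) h2
          exact this.mono (history_le henv (fun s hs hs' ↦ iht s (by omega) hs (by omega))
            (fun i hi hi' ↦ ihR n i hi (by omega))) le_rfl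
    refine ⟨hI, fun n i h1 h2 ↦ ?_⟩
    rcases Nat.lt_or_ge j i with h | h
    · obtain rfl : i = j + 1 := by omega
      have hM : ∀ q, Measurable (M q (j + 1)) := fun q ↦
        (hrun.mostPlayed_measurable q (j + 1) (by omega)).mono
          (history_le henv (fun s hs hs' ↦ hI q s hs hs')
            (fun i hi hi' ↦ ihR q i hi (by omega))) le_rfl
      have : recommendation M Q n (j + 1) =
          (fun p : Fin N × Ω ↦ M p.1 (j + 1) p.2) ∘ fun ω ↦ (Q n (j + 1) ω, ω) := rfl
      rw [this]
      exact (measurable_from_prod_countable_right fun q ↦ hM q).comp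
        ((henv.measurable_sender n (j + 1) (by omega)).prodMk measurable_id)
    · exact ihR n i h1 h

theorem IsRun.measurable_play (hrun : IsRun A S₀ X Q I M) (henv : IsEnvironment Pr μ P X Q)
    (hA₀ : A 0 = 0) (hA : StrictMono A) (n : Fin N) {t : ℕ} (ht : 1 ≤ t) :
    Measurable (I n t) :=
  (hrun.measurable_of_phase henv hA₀ t).1 n t ht (hA.id_le t)

end Measurability

/-! ### Growth of the phases and summability -/

section Summability

theorem summable_inv_mul_one_add_log_sq :
    Summable fun n : ℕ ↦ 1 / ((n : ℝ) * (1 + Real.log n) ^ 2) := by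
  -- Cauchy condensation reduces the series to one dominated by a multiple of Σ 1 / (k + 1)².
  rw [← summable_condensed_iff_of_nonneg]
  · have h2 : 0 < Real.log 2 := Real.log_pos (by norm_num)
    have hs : Summable fun k : ℕ ↦ (1 / Real.log 2 ^ 2) * (1 / ((k + 1 : ℕ) : ℝ) ^ 2) :=
      ((summable_nat_add_iff 1).2 (Real.summable_one_div_nat_pow.2 one_lt_two)).mul_left _
    refine Summable.of_nonneg_of_le (fun k ↦ by positivity) (fun k ↦ ?_) hs
    have hlog2 : Real.log 2 ≤ 1 := by linarith [Real.log_two_lt_d9]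
    have e : Real.log ((2 ^ k : ℕ) : ℝ) = k * Real.log 2 := by
      push_cast; rw [Real.log_pow]
    rw [e]
    push_cast
    have h3 : (k + 1 : ℝ) * Real.log 2 ≤ 1 + k * Real.log 2 := by linarith
    have h4 : 0 < (k + 1 : ℝ) * Real.log 2 := by positivity
    calc (2 : ℝ) ^ k * (1 / (2 ^ k * (1 + k * Real.log 2) ^ 2)) =
          1 / (1 + k * Real.log 2) ^ 2 := by field_simp
      _ ≤ 1 / ((k + 1 : ℝ) * Real.log 2) ^ 2 := by gcongr
      _ = _ := by field_simp
  · intro n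
    positivity
  · intro m n hm hmn
    have h1 : (1 : ℝ) ≤ m := by exact_mod_cast hm
    have h2 : (m : ℝ) ≤ n := by exact_mod_cast hmn
    have h3 := Real.log_nonneg h1
    have h4 := Real.log_le_log (by linarith) h2
    have : 0 < (m : ℝ) * (1 + Real.log m) ^ 2 := by positivity
    gcongr

theorem mul_one_add_log_sq_le_explore {t : ℕ} (ht : 1 ≤ t) :
    (t : ℝ) * (1 + Real.log t) ^ 2 ≤ 8 * explore t := by
  have ht' : (1 : ℝ) ≤ t := by exact_mod_cast ht
  have h0 := Real.log_nonneg ht'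
  have h1 : (t : ℝ) ≤ 3 * explore t := by
    unfold explore
    rcases le_or_gt t 2 with h | h
    · have : (t : ℝ) ≤ 2 := by exact_mod_cast h
      have : 0 ≤ (t : ℝ) * Real.log t ^ 2 := by positivity
      linarith
    · have h3 : (3 : ℝ) ≤ t := by exact_mod_cast h
      have h4 : 1 ≤ Real.log t := by
        rw [Real.le_log_iff_exp_le (by linarith)]
        linarith [Real.exp_one_lt_d9]
      have h5 : 1 ≤ Real.log t ^ 2 := one_le_pow₀ h4
      nlinarith
  have h2 : (t : ℝ) * Real.log t ^ 2 ≤ explore t := by unfold explore; linarith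
  -- From (1 + log t)² ≤ 2 + 2 log² t and the two bounds above; 8 = 2 · 3 + 2.
  nlinarith [mul_nonneg (by linarith : (0 : ℝ) ≤ t) (sq_nonneg (1 - Real.log t))]

variable {A : ℕ → ℕ} {C θ : ℝ}

/-- Bernoulli's inequality bounds the increment of h^(1+θ) by (1 + θ)(h + 1)^θ, so summing the phase
lengths gives order h^(1+θ). -/
theorem mul_rpow_le_phaseEnd (hC : 1 ≤ C) (hθ : 0 < θ)
    (hlength : ∀ j : ℕ, 1 ≤ j → C⁻¹ * (j : ℝ) ^ θ ≤ (A j : ℝ) - A (j - 1)) (h : ℕ) :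
    C⁻¹ / (1 + θ) * ((h : ℝ) * (h : ℝ) ^ θ) ≤ A h := by
  induction h with
  | zero => simp
  | succ h ih =>
    have h1 := hlength (h + 1) (by omega)
    rw [Nat.add_sub_cancel] at h1
    push_cast at h1 ⊢
    have hpos : (0 : ℝ) < h + 1 := by positivity
    have hb := one_add_mul_self_le_rpow_one_add (s := -(1 / (h + 1 : ℝ))) (p := 1 + θ)
      (by rw [neg_le_neg_iff, div_le_one hpos]; linarith [(Nat.cast_nonneg h : (0 : ℝ) ≤ h)])
      (by linarith)
    have e1 : 1 + -(1 / (h + 1 : ℝ)) = h / (h + 1) := by field_simp; ring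
    rw [e1, Real.div_rpow (Nat.cast_nonneg h) hpos.le, le_div_iff₀ (by positivity),
      Real.rpow_add hpos, Real.rpow_one, Real.rpow_add_of_nonneg (Nat.cast_nonneg h) zero_le_one
      hθ.le, Real.rpow_one] at hb
    have e2 : (1 + (1 + θ) * -(1 / (h + 1 : ℝ))) * ((h + 1) * (h + 1 : ℝ) ^ θ) =
        (h + 1) * (h + 1 : ℝ) ^ θ - (1 + θ) * (h + 1 : ℝ) ^ θ := by field_simp; ring
    rw [e2] at hb
    have hc : 0 < C⁻¹ / (1 + θ) := by positivity
    have e3 : C⁻¹ / (1 + θ) * ((1 + θ) * (h + 1 : ℝ) ^ θ) = C⁻¹ * (h + 1 : ℝ) ^ θ := by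
      field_simp
    nlinarith

theorem phaseEnd_le (hA₀ : A 0 = 0) (hC : 1 ≤ C) (hθ : 0 < θ)
    (hlength : ∀ j : ℕ, 1 ≤ j → (A j : ℝ) - A (j - 1) ≤ C * (j : ℝ) ^ θ) (h : ℕ) :
    (A h : ℝ) ≤ C * ((h : ℝ) * (h : ℝ) ^ θ) := by
  induction h with
  | zero => simp [hA₀]
  | succ h ih =>
    have h1 := hlength (h + 1) (by omega)
    rw [Nat.add_sub_cancel] at h1
    push_cast at h1 ⊢
    have h2 : (h : ℝ) ^ θ ≤ (h + 1 : ℝ) ^ θ :=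
      Real.rpow_le_rpow (Nat.cast_nonneg h) (by linarith) hθ.le
    have h3 : C * ((h : ℝ) * (h : ℝ) ^ θ) ≤ C * ((h : ℝ) * (h + 1 : ℝ) ^ θ) := by gcongr
    linarith

theorem add_one_rpow_le (hθ : 0 < θ) {h : ℕ} (hh : 1 ≤ h) :
    ((h : ℝ) + 1) ^ θ ≤ 2 ^ θ * (h : ℝ) ^ θ := by
  have : (1 : ℝ) ≤ h := by exact_mod_cast hh
  rw [← Real.mul_rpow (by norm_num) (by linarith)]
  exact Real.rpow_le_rpow (by positivity) (by linarith) hθ.le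

/-- The critical series: f(A_h) is at least of order h^(1+θ) (1 + log h)², which leaves 1 / (h (1 +
log h)²) after weighting by the phase length. -/
theorem summable_rpow_div_explore (hA : StrictMono A) (hC : 1 ≤ C)
    (hθ : 0 < θ) (hlength : ∀ j : ℕ, 1 ≤ j → C⁻¹ * (j : ℝ) ^ θ ≤ (A j : ℝ) - A (j - 1)) :
    Summable fun h : ℕ ↦ ((h : ℝ) + 1) ^ θ / explore (A h) := by
  set c : ℝ := C⁻¹ / (1 + θ)
  have hc : 0 < c := by positivity
  refine Summable.of_norm_bounded_eventually_nat
    (summable_inv_mul_one_add_log_sq.mul_left (2 ^ θ * 8 / c)) ?_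
  filter_upwards [eventually_ge_atTop 1] with h hh
  have hh' : (1 : ℝ) ≤ h := by exact_mod_cast hh
  have hAh : h ≤ A h := hA.id_le h
  have hAh' : (h : ℝ) ≤ A h := by exact_mod_cast hAh
  have h1 := mul_one_add_log_sq_le_explore (hh.trans hAh)
  have h2 := mul_rpow_le_phaseEnd hC hθ hlength h
  have h3 : Real.log h ≤ Real.log (A h) := Real.log_le_log (by linarith) hAh'
  have h4 := Real.log_nonneg hh'
  have hy : 0 < (h : ℝ) ^ θ := by positivity
  have hf : 0 < explore (A h) := by linarith [one_le_explore (A h)]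
  rw [Real.norm_of_nonneg (by positivity), div_le_iff₀ hf]
  have h5 : c * ((h : ℝ) * (h : ℝ) ^ θ) * (1 + Real.log h) ^ 2 ≤ 8 * explore (A h) := by
    refine le_trans ?_ h1
    gcongr
  calc ((h : ℝ) + 1) ^ θ ≤ 2 ^ θ * (h : ℝ) ^ θ := add_one_rpow_le hθ hh
    _ = 2 ^ θ / c * (1 / ((h : ℝ) * (1 + Real.log h) ^ 2)) *
        (c * ((h : ℝ) * (h : ℝ) ^ θ) * (1 + Real.log h) ^ 2) := by field_simp
    _ ≤ 2 ^ θ / c * (1 / ((h : ℝ) * (1 + Real.log h) ^ 2)) * (8 * explore (A h)) := by gcongr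
    _ = _ := by ring

theorem summable_rpow_mul_exp_neg_rpow (hθ : 0 < θ) {a : ℝ} (ha : 0 < a) :
    Summable fun h : ℕ ↦ ((h : ℝ) + 1) ^ θ * Real.exp (-(a * (h : ℝ) ^ θ)) := by
  -- With y = h^θ the power y^(1 + 2/θ) is h^θ h², so the terms are eventually dominated by a
  -- multiple of 1 / h².
  have hlim := (tendsto_rpow_mul_exp_neg_mul_atTop_nhds_zero (1 + 2 / θ) a ha).comp
    ((tendsto_rpow_atTop hθ).comp tendsto_natCast_atTop_atTop)
  refine Summable.of_norm_bounded_eventually_nat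
    ((Real.summable_one_div_nat_pow.2 one_lt_two).mul_left (2 ^ θ)) ?_
  filter_upwards [eventually_ge_atTop 1, hlim.eventually (gt_mem_nhds one_pos)] with h hh h1
  have hh' : (0 : ℝ) < h := by exact_mod_cast hh
  simp only [Function.comp, Real.rpow_add (show 0 < (h : ℝ) ^ θ by positivity),
    ← Real.rpow_mul hh'.le, mul_one] at h1
  have e : θ * (2 / θ) = (2 : ℕ) := by push_cast; field_simp
  rw [e, Real.rpow_natCast] at h1
  rw [Real.norm_of_nonneg (by positivity)]
  calc ((h : ℝ) + 1) ^ θ * Real.exp (-(a * (h : ℝ) ^ θ))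
      ≤ 2 ^ θ * (h : ℝ) ^ θ * Real.exp (-(a * (h : ℝ) ^ θ)) := by
        gcongr; exact add_one_rpow_le hθ hh
    _ = 2 ^ θ * (1 / (h : ℝ) ^ 2) *
        ((h : ℝ) ^ θ * (h : ℝ) ^ 2 * Real.exp (-a * (h : ℝ) ^ θ)) := by
        rw [neg_mul]; field_simp
    _ ≤ 2 ^ θ * (1 / (h : ℝ) ^ 2) * 1 := by gcongr
    _ = _ := mul_one _

theorem summable_rpow_mul_geometric (hθ : 0 < θ) {r : ℝ} (hr0 : 0 ≤ r) (hr : r < 1) :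
    Summable fun h : ℕ ↦ ((h : ℝ) + 1) ^ θ * r ^ h := by
  have hs := summable_pow_mul_geometric_of_norm_lt_one ⌈θ⌉₊
    (r := r) (by rwa [Real.norm_of_nonneg hr0])
  refine Summable.of_norm_bounded_eventually_nat (hs.mul_left (2 ^ θ)) ?_
  filter_upwards [eventually_ge_atTop 1] with h hh
  have hh' : (1 : ℝ) ≤ h := by exact_mod_cast hh
  rw [Real.norm_of_nonneg (by positivity), ← mul_assoc]
  have : (h : ℝ) ^ θ ≤ (h : ℝ) ^ ⌈θ⌉₊ := by
    rw [← Real.rpow_natCast]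
    exact Real.rpow_le_rpow_of_exponent_le hh' (Nat.le_ceil θ)
  gcongr
  exact (add_one_rpow_le hθ hh).trans (by gcongr)

/-- Each value of j / b is taken exactly b times. -/
theorem summable_comp_div {f : ℕ → ℝ} (hf : Summable f) {b : ℕ} (hb : b ≠ 0) :
    Summable fun j ↦ f (j / b) := by
  have : NeZero b := ⟨hb⟩
  rw [← (Nat.divModEquiv b).symm.summable_iff]
  have : ((fun j ↦ f (j / b)) ∘ (Nat.divModEquiv b).symm) = fun p : ℕ × Fin b ↦ f p.1 := by
    funext p
    have h1 := congrArg Prod.fst ((Nat.divModEquiv b).apply_symm_apply p)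
    simp only [Nat.divModEquiv, Equiv.coe_fn_mk] at h1
    simp only [Function.comp]
    exact congrArg f h1
  rw [this]
  have h := (Summable.mul_of_nonneg (f := fun n ↦ |f n|) (g := fun _ : Fin b ↦ (1 : ℝ))
    hf.abs (Summable.of_finite) (fun _ ↦ abs_nonneg _) (fun _ ↦ zero_le_one))
  refine Summable.of_abs ?_
  simpa using h

/-- This supplies the phase length needed for `mostPlayed_eq`. The coefficient 1 / (2CK) makes the
sample-size term at most half of the minimal length i^θ / C; the logarithmic term is o(i^θ) and
eventually takes at most another quarter. -/
theorem eventually_phase_long (hA₀ : A 0 = 0) (hA : StrictMono A) (hC : 1 ≤ C) (hθ : 0 < θ)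
    (hlength : ∀ j : ℕ, 1 ≤ j →
      C⁻¹ * (j : ℝ) ^ θ ≤ (A j : ℝ) - A (j - 1) ∧ (A j : ℝ) - A (j - 1) ≤ C * (j : ℝ) ^ θ)
    {K : ℕ} (hK : 1 ≤ K) (d₀ : ℝ) (hd₀ : 0 < d₀) :
    ∃ h₀ : ℕ, 1 ≤ h₀ ∧ ∀ h, h₀ ≤ h → ∀ i, h < i →
      K * ((⌊1 / (2 * C * K) * (h : ℝ) ^ θ⌋₊ : ℝ) + Real.log (explore (A i)) / d₀ + 2) <
        (A i : ℝ) - A (i - 1) := by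
  have hK0 : (0 : ℝ) < K := by exact_mod_cast hK
  have hC0 : 0 < C := by linarith
  have hup : ∀ i : ℕ, 1 ≤ i → Real.log (explore (A i)) ≤
      Real.log 2 + 3 * Real.log C + 3 * (1 + θ) * Real.log i := by
    intro i hi
    have hi0 : (0 : ℝ) < i := by exact_mod_cast hi
    have hAi : (1 : ℝ) ≤ A i := by exact_mod_cast hi.trans (hA.id_le i)
    have h1 : explore (A i) ≤ 2 * (A i : ℝ) ^ 3 := by
      unfold explore
      have h2 : Real.log (A i) ≤ A i := (Real.log_le_sub_one_of_pos (by linarith)).trans (by linarith)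
      have h3 : (A i : ℝ) * Real.log (A i) ^ 2 ≤ A i * (A i : ℝ) ^ 2 := by
        have := Real.log_nonneg hAi
        gcongr
      have h4 : (1 : ℝ) ≤ (A i : ℝ) ^ 3 := one_le_pow₀ hAi
      nlinarith
    have h5 := phaseEnd_le hA₀ hC hθ (fun j hj ↦ (hlength j hj).2) i
    have h6 : Real.log (A i) ≤ Real.log C + (1 + θ) * Real.log i := by
      refine (Real.log_le_log (by linarith) h5).trans_eq ?_
      rw [Real.log_mul hC0.ne' (by positivity), Real.log_mul hi0.ne' (by positivity),
        Real.log_rpow hi0]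
      ring
    have h7 : Real.log (explore (A i)) ≤ Real.log 2 + 3 * Real.log (A i) := by
      refine (Real.log_le_log (by linarith [one_le_explore (A i)]) h1).trans_eq ?_
      rw [Real.log_mul (by norm_num) (by positivity), Real.log_pow]
      push_cast; ring
    linarith
  have hlim : Tendsto (fun i : ℕ ↦ (i : ℝ) ^ θ) atTop atTop :=
    (tendsto_rpow_atTop hθ).comp tendsto_natCast_atTop_atTop
  have ho : (fun i : ℕ ↦ K * ((Real.log 2 + 3 * Real.log C + 3 * (1 + θ) * Real.log i) / d₀ + 2))
      =o[atTop] fun i : ℕ ↦ (i : ℝ) ^ θ := by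
    have h1 : (fun i : ℕ ↦ Real.log i) =o[atTop] fun i : ℕ ↦ (i : ℝ) ^ θ :=
      (isLittleO_log_rpow_atTop hθ).comp_tendsto tendsto_natCast_atTop_atTop
    have h2 : ∀ b : ℝ, (fun _ : ℕ ↦ b) =o[atTop] fun i : ℕ ↦ (i : ℝ) ^ θ := fun b ↦
      Asymptotics.isLittleO_const_left.2 (Or.inr (tendsto_norm_atTop_atTop.comp hlim))
    have h3 := (h1.const_mul_left (K * (3 * (1 + θ)) / d₀)).add
      (h2 (K * ((Real.log 2 + 3 * Real.log C) / d₀ + 2)))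
    refine h3.congr_left fun i ↦ ?_
    field_simp
    ring
  have hev := ho.def (show 0 < 1 / (4 * C) by positivity)
  obtain ⟨h₁, hh₁⟩ := eventually_atTop.1 hev
  refine ⟨max h₁ 1, le_max_right _ _, fun h hh i hi ↦ ?_⟩
  have hi1 : 1 ≤ i := by omega
  have hi0 : (0 : ℝ) < i := by exact_mod_cast hi1
  have h1 := hh₁ i (by have := le_max_left h₁ 1; omega)
  have hy : 0 < (i : ℝ) ^ θ := by positivity
  rw [Real.norm_of_nonneg hy.le] at h1
  have h2 := (le_abs_self _).trans h1
  have h3 : (⌊1 / (2 * C * K) * (h : ℝ) ^ θ⌋₊ : ℝ) ≤ 1 / (2 * C * K) * (i : ℝ) ^ θ := by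
    refine (Nat.floor_le (by positivity)).trans ?_
    have : (h : ℝ) ≤ i := by exact_mod_cast hi.le
    gcongr
  have h4 : Real.log (explore (A i)) / d₀ ≤
      (Real.log 2 + 3 * Real.log C + 3 * (1 + θ) * Real.log i) / d₀ := by
    have := hup i hi1
    gcongr
  calc K * ((⌊1 / (2 * C * K) * (h : ℝ) ^ θ⌋₊ : ℝ) + Real.log (explore (A i)) / d₀ + 2)
      ≤ K * (1 / (2 * C * K) * (i : ℝ) ^ θ +
        (Real.log 2 + 3 * Real.log C + 3 * (1 + θ) * Real.log i) / d₀ + 2) := by gcongr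
    _ = 1 / (2 * C) * (i : ℝ) ^ θ +
        K * ((Real.log 2 + 3 * Real.log C + 3 * (1 + θ) * Real.log i) / d₀ + 2) := by
        field_simp
        ring
    _ ≤ 1 / (2 * C) * (i : ℝ) ^ θ + 1 / (4 * C) * (i : ℝ) ^ θ := by gcongr
    _ < C⁻¹ * (i : ℝ) ^ θ := by
        rw [← add_mul]
        refine mul_lt_mul_of_pos_right ?_ hy
        have : 1 / (2 * C) + 1 / (4 * C) = 3 / 4 * C⁻¹ := by field_simp; norm_num
        rw [this]
        have : 0 < C⁻¹ := by positivity
        linarith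
    _ ≤ _ := (hlength i hi1).1

end Summability

end AOGB

/-! ### Choice of thresholds, exceptional events and expected play counts -/

namespace AOGB

/-- Thresholds separating the means of the other arms from that of the best arm. -/
structure Thresholds {K : ℕ} (μ : Fin K → unitInterval) (star : Fin K) (ν ν' q d₀ : ℝ)
    (x d : Fin K → ℝ) : Prop where
  pos : 0 < ν
  lt : ν < ν'
  lt_q : ν' < q
  q_lt : q < 1
  q_le : q ≤ μ star
  lt_x : ∀ k, k ≠ star → (μ k : ℝ) < x k
  x_le : ∀ k, k ≠ star → x k ≤ ν
  d₀_pos : 0 < d₀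
  d₀_le : ∀ k, k ≠ star → d₀ ≤ d k
  d_le : ∀ k, k ≠ star → d k ≤ klReal (x k) ν

namespace Thresholds

variable {K : ℕ} {μ : Fin K → unitInterval} {star : Fin K} {ν ν' q d₀ : ℝ} {x d : Fin K → ℝ}

theorem x_pos (hth : Thresholds μ star ν ν' q d₀ x d) {k : Fin K} (hk : k ≠ star) : 0 < x k :=
  (μ k).2.1.trans_lt (hth.lt_x k hk)

theorem d_pos (hth : Thresholds μ star ν ν' q d₀ x d) {k : Fin K} (hk : k ≠ star) : 0 < d k :=
  hth.d₀_pos.trans_le (hth.d₀_le k hk)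

theorem ν'_lt (hth : Thresholds μ star ν ν' q d₀ x d) : ν' < 1 := hth.lt_q.trans hth.q_lt

end Thresholds

theorem exists_thresholds {K : ℕ} {μ : Fin K → unitInterval} {star : Fin K}
    (hstar : ∀ k, k ≠ star → μ k < μ star) (hμ : (0 : ℝ) < μ star) {d : Fin K → ℝ}
    (hd0 : ∀ k, k ≠ star → 0 < d k)
    (hd : ∀ k, k ≠ star → ENNReal.ofReal (d k) < klBer (μ k) (μ star)) :
    ∃ ν ν' q d₀ x, Thresholds μ star ν ν' q d₀ x d := by
  have h : ∀ k, ∃ x y, k ≠ star → (μ k : ℝ) < x ∧ x < y ∧ y < μ star ∧ d k < klReal x y := by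
    intro k
    by_cases hk : k = star
    · exact ⟨0, 0, fun h ↦ absurd hk h⟩
    · obtain ⟨x, y, hxy⟩ := exists_lt_klReal (μ k).2.1 (hstar k hk) (μ star).2.2 (hd k hk)
      exact ⟨x, y, fun _ ↦ hxy⟩
  choose x y hxy using h
  -- The value at `star` makes the maximum exist and be positive even if there is no other arm; the
  -- value 1 in `u` below plays the same role for the minimum.
  set z : Fin K → ℝ := fun k ↦ if k = star then μ star / 2 else y k with hz
  obtain ⟨k₀, -, hk₀⟩ := exists_max_image univ z ⟨star, mem_univ _⟩
  set ν := z k₀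
  have hzlt : ∀ k, z k < μ star := by
    intro k
    simp only [hz]
    split_ifs with hk
    · linarith
    · exact (hxy k hk).2.2.1
  have hνstar : ν < μ star := hzlt k₀
  have hν0 : 0 < ν := by
    have h1 := hk₀ star (mem_univ _)
    have h2 : z star = μ star / 2 := by simp [hz]
    linarith
  have hyν : ∀ k, k ≠ star → y k ≤ ν := by
    intro k hk
    have := hk₀ k (mem_univ _)
    have h2 : z k = y k := by simp [hz, hk]
    linarith
  have h1 := (μ star).2.2
  set g : ℝ := (μ star : ℝ) - ν with hg
  have hg0 : 0 < g := by linarith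
  set u : Fin K → ℝ := fun k ↦ if k = star then 1 else d k with hu
  obtain ⟨k₁, -, hk₁⟩ := exists_min_image univ u ⟨star, mem_univ _⟩
  refine ⟨ν, ν + g / 3, ν + g / 2, u k₁, x, ?_⟩
  refine ⟨hν0, by linarith, by linarith, by linarith, by linarith, fun k hk ↦ (hxy k hk).1,
    fun k hk ↦ (hxy k hk).2.1.le.trans (hyν k hk), ?_, fun k hk ↦ ?_, fun k hk ↦ ?_⟩
  · by_cases hk : k₁ = star
    · simp [hu, hk]
    · simpa [hu, hk] using hd0 k₁ hk
  · have := hk₁ k (mem_univ _)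
    have h2 : u k = d k := by simp [hu, hk]
    linarith
  · have h2 := (hxy k hk)
    exact h2.2.2.2.le.trans (klReal_mono_right
      (((μ k).2.1.trans_lt h2.1).trans h2.2.1) h2.2.1.le (hyν k hk) (by linarith))

variable {Ω : Type*} [MeasurableSpace Ω] {Pr : Measure Ω}
  {N K : ℕ} {μ : Fin K → unitInterval} {P : Matrix (Fin N) (Fin N) ℝ}
  {X : Fin N → Fin K → ℕ → Ω → ℝ} {Q : Fin N → ℕ → Ω → Fin N}
  {A : ℕ → ℕ} {S₀ : Fin N → Finset (Fin K)} {I M : Fin N → ℕ → Ω → Fin K}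
  {star : Fin K} {ν ν' q d₀ : ℝ} {x d : Fin K → ℝ}

theorem measurableSet_badEvent (henv : IsEnvironment Pr μ P X Q) (A : ℕ → ℕ) (star : Fin K)
    (ν : ℝ) (x : Fin K → ℝ) (m : ℕ → ℕ) (L h : ℕ) :
    MeasurableSet (badEvent A P X Q star ν x m L h) := by
  refine ((MeasurableSet.iUnion fun n ↦ henv.measurableSet_indexLow ν n star _).union
    (MeasurableSet.iUnion fun n ↦ MeasurableSet.iUnion fun k ↦ MeasurableSet.iUnion fun _ ↦
      henv.measurableSet_meanHigh (x k) n k _)).union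
    (MeasurableSet.iUnion fun n ↦ MeasurableSet.iUnion fun q ↦ MeasurableSet.iUnion fun _ ↦
      MeasurableSet.iUnion fun l ↦ MeasurableSet.iUnion fun _ ↦
        henv.measurableSet_noContact n q _ h)

theorem measureReal_iUnion_prop_le {p : Prop} [Decidable p] {E : Set Ω} {b : ℝ}
    (h : p → Pr.real E ≤ b) : Pr.real (⋃ _ : p, E) ≤ if p then b else 0 := by
  split_ifs with hp
  · simpa [hp] using h hp
  · simp [hp]

variable [IsProbabilityMeasure Pr]

theorem measureReal_badEvent_le (henv : IsEnvironment Pr μ P X Q)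
    (hth : Thresholds μ star ν ν' q d₀ x d) (A : ℕ → ℕ) (m : ℕ → ℕ) (L h : ℕ) :
    Pr.real (badEvent A P X Q star ν' x m L h) ≤
      ∑ _n : Fin N, (∑' s : ℕ, ((s : ℝ) + 1) * Real.exp (-(klReal ν' q * s))) / explore (A h) +
      ∑ _n : Fin N, ∑ k, (if k ≠ star then
        (∑' s : ℕ, 2 * Real.exp (-(2 * (x k - μ k) ^ 2 * s))) *
          Real.exp (-(2 * (x k - μ k) ^ 2 * m h)) else 0) +
      ∑ n : Fin N, ∑ q, (if 0 < P n q then L * (1 - P n q) ^ h else 0) := by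
  classical
  unfold badEvent
  refine (measureReal_union_le _ _).trans (add_le_add ((measureReal_union_le _ _).trans
    (add_le_add ?_ ?_)) ?_)
  · refine (measureReal_iUnion_fintype_le _).trans (sum_le_sum fun n _ ↦ ?_)
    exact henv.measureReal_indexLow_le n star (hth.pos.trans hth.lt) hth.lt_q hth.q_lt hth.q_le _
  · refine (measureReal_iUnion_fintype_le _).trans (sum_le_sum fun n _ ↦ ?_)
    refine (measureReal_iUnion_fintype_le _).trans (sum_le_sum fun k _ ↦ ?_)
    exact measureReal_iUnion_prop_le fun hk ↦ henv.measureReal_meanHigh_le n k (hth.lt_x k hk) _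
  · refine (measureReal_iUnion_fintype_le _).trans (sum_le_sum fun n _ ↦ ?_)
    refine (measureReal_iUnion_fintype_le _).trans (sum_le_sum fun q _ ↦ ?_)
    refine measureReal_iUnion_prop_le fun hq ↦ ?_
    refine (measureReal_biUnion_finset_le _ _).trans ?_
    refine (sum_le_sum fun l _ ↦ henv.measureReal_noContact_le n q _ h hq.le).trans_eq ?_
    simp

theorem summable_rpow_mul_measureReal_badEvent (henv : IsEnvironment Pr μ P X Q)
    (hth : Thresholds μ star ν ν' q d₀ x d) (hA : StrictMono A) {C θ : ℝ} (hC : 1 ≤ C)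
    (hθ : 0 < θ) (hlength : ∀ j : ℕ, 1 ≤ j → C⁻¹ * (j : ℝ) ^ θ ≤ (A j : ℝ) - A (j - 1))
    {ρ : ℝ} (hρ : 0 < ρ) (L : ℕ) :
    Summable fun h : ℕ ↦ ((h : ℝ) + 1) ^ θ *
      Pr.real (badEvent A P X Q star ν' x (fun h ↦ ⌊ρ * (h : ℝ) ^ θ⌋₊) L h) := by
  refine Summable.of_nonneg_of_le (fun h ↦ by positivity) (fun h ↦ mul_le_mul_of_nonneg_left
    (measureReal_badEvent_le henv hth A _ L h) (by positivity)) ?_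
  simp_rw [mul_add, mul_sum]
  refine ((summable_sum fun n _ ↦ ?_).add (summable_sum fun n _ ↦ summable_sum fun k _ ↦ ?_)).add
    (summable_sum fun n _ ↦ summable_sum fun q _ ↦ ?_)
  · refine ((summable_rpow_div_explore hA hC hθ hlength).mul_left
      (∑' s : ℕ, ((s : ℝ) + 1) * Real.exp (-(klReal ν' q * s)))).congr fun h ↦ ?_
    ring
  · split_ifs with hk
    · set c : ℝ := 2 * (x k - μ k) ^ 2
      have hc : 0 < c := by
        have : 0 < x k - μ k := sub_pos.2 (hth.lt_x k hk)
        positivity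
      set b : ℝ := ∑' s : ℕ, 2 * Real.exp (-(c * s))
      have hb : 0 ≤ b := tsum_nonneg fun s ↦ by positivity
      refine Summable.of_nonneg_of_le (fun h ↦ by positivity) (fun h ↦ ?_)
        ((summable_rpow_mul_exp_neg_rpow hθ (mul_pos hc hρ)).mul_left (b * Real.exp c))
      have h1 : Real.exp (-(c * ⌊ρ * (h : ℝ) ^ θ⌋₊)) ≤
          Real.exp c * Real.exp (-(c * ρ * (h : ℝ) ^ θ)) := by
        rw [← Real.exp_add]
        apply Real.exp_le_exp.2
        have := (Nat.lt_floor_add_one (ρ * (h : ℝ) ^ θ)).le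
        nlinarith
      calc ((h : ℝ) + 1) ^ θ * (b * Real.exp (-(c * ⌊ρ * (h : ℝ) ^ θ⌋₊)))
          ≤ ((h : ℝ) + 1) ^ θ * (b * (Real.exp c * Real.exp (-(c * ρ * (h : ℝ) ^ θ)))) := by
            gcongr
        _ = _ := by ring
    · simp
  · split_ifs with hq
    · refine ((summable_rpow_mul_geometric hθ (r := 1 - P n q)
        (sub_nonneg.2 (henv.prob_sender_le_one n q)) (by linarith)).mul_left (L : ℝ)).congr
        fun h ↦ ?_
      ring
    · simp

/-- There are exceptional events, of finite total weight, outside which the best arm has spread to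
all agents and is never underestimated. -/
theorem exists_exceptional_events (henv : IsEnvironment Pr μ P X Q) (hrun : IsRun A S₀ X Q I M)
    (hth : Thresholds μ star ν ν' q d₀ x d) (hA₀ : A 0 = 0) (hA : StrictMono A) {C θ : ℝ}
    (hC : 1 ≤ C) (hθ : 0 < θ)
    (hlength : ∀ j : ℕ, 1 ≤ j →
      C⁻¹ * (j : ℝ) ^ θ ≤ (A j : ℝ) - A (j - 1) ∧ (A j : ℝ) - A (j - 1) ≤ C * (j : ℝ) ^ θ)
    (hconn : @Quiver.IsStronglyConnected (Fin N) P.toQuiver) (hS : ∃ a, star ∈ S₀ a) :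
    ∃ (B : ℕ → Set Ω) (C₀ : ℝ), (∀ j, MeasurableSet (B j)) ∧
      (∀ T, ∑ j ∈ Icc 1 T, ((A j : ℝ) - A (j - 1)) * Pr.real (B j) ≤ C₀) ∧
      ∀ j, 1 ≤ j → ∀ ω, ω ∉ B j → ∀ n,
        star ∈ activeSet S₀ M Q n j ω ∧ activeSet S₀ M Q n j ω ⊆ insert star (S₀ n) ∧
        ω ∉ indexLow X ν' n star (A (j - 1)) := by
  obtain ⟨a, ha⟩ := hS
  obtain ⟨L, hL⟩ := exists_reachIn hconn a
  have hK : 1 ≤ K := Fin.pos star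
  have hK0 : (0 : ℝ) < K := by exact_mod_cast hK
  obtain ⟨h₀, hh₀, hlong⟩ := eventually_phase_long hA₀ hA hC hθ hlength hK d₀ hth.d₀_pos
  set ρ : ℝ := 1 / (2 * C * K)
  have hρ : 0 < ρ := by positivity
  set m : ℕ → ℕ := fun h ↦ ⌊ρ * (h : ℝ) ^ θ⌋₊
  -- Scales below `h₀`, where phases may be too short, are declared exceptional outright; finitely
  -- many terms do not affect summability. Phase j is governed by scale j / (L + 3), which leaves
  -- time for the spread.
  set E : ℕ → Set Ω := fun h ↦ if h₀ ≤ h then badEvent A P X Q star ν' x m L h else Set.univ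
    with hE
  have hsum : Summable fun h : ℕ ↦ ((h : ℝ) + 1) ^ θ * Pr.real (E h) := by
    have h1 := summable_rpow_mul_measureReal_badEvent henv hth hA hC hθ
      (fun j hj ↦ (hlength j hj).1) hρ L
    refine (summable_congr_atTop ?_).2 h1
    filter_upwards [eventually_ge_atTop h₀] with h hh
    simp only [hE, if_pos hh, m]
  have hsum' := (summable_comp_div hsum (b := L + 3) (by omega)).mul_left
    (C * ((L + 3 : ℕ) : ℝ) ^ θ)
  refine ⟨fun j ↦ E (j / (L + 3)), ∑' j : ℕ, C * ((L + 3 : ℕ) : ℝ) ^ θ *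
    (((j / (L + 3) : ℕ) + 1 : ℝ) ^ θ * Pr.real (E (j / (L + 3)))), fun j ↦ ?_, fun T ↦ ?_, ?_⟩
  · simp only [hE]
    split_ifs
    · exact measurableSet_badEvent henv _ _ _ _ _ _ _
    · exact MeasurableSet.univ
  · refine le_trans (sum_le_sum fun j hj ↦ ?_)
      (hsum'.sum_le_tsum (Icc 1 T) fun j _ ↦ by positivity)
    rw [← mul_assoc]
    refine mul_le_mul_of_nonneg_right ?_ measureReal_nonneg
    refine (hlength j (mem_Icc.1 hj).1).2.trans ?_
    rw [mul_assoc, ← Real.mul_rpow (by positivity) (by positivity)]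
    have h1 : (j : ℝ) ≤ ((L + 3 : ℕ) : ℝ) * ((j / (L + 3) : ℕ) + 1 : ℝ) := by
      have := (Nat.lt_mul_div_succ j (show 0 < L + 3 by omega)).le
      exact_mod_cast this
    have h2 := Real.rpow_le_rpow (Nat.cast_nonneg j) h1 hθ.le
    gcongr
  · intro j hj ω hω n
    have hh : h₀ ≤ j / (L + 3) := by
      by_contra hcon
      simp [hE, hcon] at hω
    simp only [hE, if_pos hh] at hω
    exact hrun.activeSet_of_notMem_badEvent hA ha hL
      (fun k hk ↦ ⟨hth.x_pos hk, hth.x_le k hk⟩) hth.lt hth.ν'_lt hth.d₀_pos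
      (fun k hk ↦ ⟨hth.d₀_le k hk, hth.d_le k hk⟩)
      (fun n k s ↦ henv.sampleMean_mem_Icc n k s ω) (hh₀.trans hh)
      (Nat.mul_div_le j (L + 3)) (hlong _ hh) hω n

theorem integrable_playCount (henv : IsEnvironment Pr μ P X Q) (hrun : IsRun A S₀ X Q I M)
    (hA₀ : A 0 = 0) (hA : StrictMono A) (n : Fin N) (k : Fin K) (T : ℕ) :
    Integrable (fun ω ↦ (playCount I n k T ω : ℝ)) Pr := by
  refine Integrable.of_bound (C := T) ?_ (Eventually.of_forall fun ω ↦ ?_)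
  · have := measurable_playCount (I := I) (n := n) (t := T)
      (fun s hs _ ↦ hrun.measurable_play henv hA₀ hA n hs) k
    exact (measurable_from_top.comp this).aestronglyMeasurable
  · rw [Real.norm_of_nonneg (Nat.cast_nonneg _)]
    exact_mod_cast playCount_le I n k ω T

theorem sum_measureReal_lt_sampleMean_le (henv : IsEnvironment Pr μ P X Q) (n : Fin N)
    {k : Fin K} {x : ℝ} (hx : μ k < x) (T : ℕ) :
    ∑ v ∈ Icc 1 T, Pr.real {ω | x < sampleMean X n k v ω} ≤
      ∑' v : ℕ, 2 * Real.exp (-(2 * (x - μ k) ^ 2 * v)) := by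
  have hc : 0 < 2 * (x - μ k) ^ 2 := by
    have : 0 < x - μ k := sub_pos.2 hx
    positivity
  refine le_trans (sum_le_sum fun v hv ↦ henv.measureReal_lt_sampleMean_le n k hx
    (mem_Icc.1 hv).1) ?_
  exact ((summable_exp_neg_mul_nat hc).mul_left 2).sum_le_tsum _ fun v _ ↦ by positivity

/-- Integrates `playCount_le_sum`. Exceptional phases and excessive sample means contribute
convergent series, so the constant is uniform in agent, arm and horizon. -/
theorem exists_integral_playCount_le (henv : IsEnvironment Pr μ P X Q)
    (hrun : IsRun A S₀ X Q I M) (hth : Thresholds μ star ν ν' q d₀ x d) (hA₀ : A 0 = 0)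
    (hA : StrictMono A) {C θ : ℝ} (hC : 1 ≤ C) (hθ : 0 < θ)
    (hlength : ∀ j : ℕ, 1 ≤ j →
      C⁻¹ * (j : ℝ) ^ θ ≤ (A j : ℝ) - A (j - 1) ∧ (A j : ℝ) - A (j - 1) ≤ C * (j : ℝ) ^ θ)
    (hconn : @Quiver.IsStronglyConnected (Fin N) P.toQuiver) (hS : ∃ a, star ∈ S₀ a) :
    ∃ C₁ : ℝ, ∀ n, ∀ k, k ≠ star → ∀ T, ∫ ω, (playCount I n k T ω : ℝ) ∂Pr ≤
      C₁ + if k ∈ S₀ n then Real.log (explore T) / d k else 0 := by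
  obtain ⟨B, C₀, hBm, hBsum, hB⟩ := exists_exceptional_events henv hrun hth hA₀ hA hC hθ hlength
    hconn hS
  set Z : Fin K → ℝ := fun k ↦ ∑' v : ℕ, 2 * Real.exp (-(2 * (x k - μ k) ^ 2 * v))
  have hZ : ∀ k, 0 ≤ Z k := fun k ↦ tsum_nonneg fun v ↦ by positivity
  refine ⟨C₀ + 1 + ∑ k, Z k, fun n k hk T ↦ ?_⟩
  have hpt : ∀ ω, (playCount I n k T ω : ℝ) ≤ _ := fun ω ↦
    hrun.playCount_le_sum hA₀ hA hk (hth.x_pos hk) (hth.x_le k hk) hth.lt hth.ν'_lt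
      (hth.d_pos hk) (hth.d_le k hk) (fun k s ↦ henv.sampleMean_mem_Icc n k s ω)
      (B := B) (fun j hj hω ↦ hB j hj ω hω n) T
  have hm : ∀ v, MeasurableSet {ω | x k < sampleMean X n k v ω} := fun v ↦
    measurableSet_lt measurable_const (henv.measurable_sampleMean n k v)
  have hi1 : ∀ j, Integrable (fun ω ↦ ((A j : ℝ) - A (j - 1)) * (B j).indicator 1 ω) Pr :=
    fun j ↦ ((integrable_const (1 : ℝ)).indicator (hBm j)).const_mul _
  have hi2 : ∀ v, Integrable
      (fun ω ↦ {ω | x k < sampleMean X n k v ω}.indicator (1 : Ω → ℝ) ω) Pr :=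
    fun v ↦ (integrable_const (1 : ℝ)).indicator (hm v)
  have hI1 : Integrable (fun ω ↦ ∑ j ∈ Icc 1 T, ((A j : ℝ) - A (j - 1)) * (B j).indicator 1 ω)
      Pr := integrable_finsetSum _ fun j _ ↦ hi1 j
  have hI2 : Integrable (fun ω ↦ if k ∈ S₀ n then Real.log (explore T) / d k + 1 +
      ∑ v ∈ Icc 1 T, {ω | x k < sampleMean X n k v ω}.indicator 1 ω else 0) Pr := by
    split_ifs
    · exact (integrable_const _).add (integrable_finsetSum _ fun v _ ↦ hi2 v)
    · exact integrable_zero _ _ _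
  refine (integral_mono (integrable_playCount henv hrun hA₀ hA n k T) (hI1.add hI2) hpt).trans ?_
  simp only [Pi.add_apply]
  rw [integral_add hI1 hI2, integral_finsetSum _ fun j _ ↦ hi1 j]
  have e1 : ∑ j ∈ Icc 1 T, ∫ ω, ((A j : ℝ) - A (j - 1)) * (B j).indicator 1 ω ∂Pr =
      ∑ j ∈ Icc 1 T, ((A j : ℝ) - A (j - 1)) * Pr.real (B j) :=
    sum_congr rfl fun j _ ↦ by rw [integral_const_mul, integral_indicator_one (hBm j)]
  rw [e1]
  have h1 := hBsum T
  have h2 : Z k ≤ ∑ k, Z k := single_le_sum (fun k _ ↦ hZ k) (mem_univ k)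
  have h3 := hZ k
  split_ifs with hkS
  · rw [integral_add (integrable_const _) (integrable_finsetSum _ fun v _ ↦ hi2 v),
      integral_finsetSum _ fun v _ ↦ hi2 v,
      sum_congr rfl fun v _ ↦ integral_indicator_one (hm v)]
    have h4 := sum_measureReal_lt_sampleMean_le henv n (hth.lt_x k hk) T
    simp only [integral_const, probReal_univ, one_smul]
    linarith
  · simp only [integral_zero]
    linarith

end AOGB

/-! ### From play counts to regret -/

namespace AOGB

theorem sum_reward_eq {Ω : Type*} {N K : ℕ} (X : Fin N → Fin K → ℕ → Ω → ℝ)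
    (I : Fin N → ℕ → Ω → Fin K) (n : Fin N) (T : ℕ) (ω : Ω) :
    ∑ t ∈ Icc 1 T, reward X I n t ω =
      ∑ k, ∑ i ∈ range (playCount I n k T ω), X n k (i + 1) ω := by
  induction T with
  | zero => simp [playCount]
  | succ T ih =>
    rw [sum_Icc_succ_top (by omega), ih]
    have hstep : ∀ k, playCount I n k (T + 1) ω =
        playCount I n k T ω + if I n (T + 1) ω = k then 1 else 0 := by
      intro k
      rw [playCount_eq_add I n k ω (Nat.le_succ T)]
      congr 1
      have : Ioc T (T + 1) = {T + 1} := by ext s; simp only [mem_Ioc, mem_singleton]; omega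
      rw [Nat.succ_eq_add_one, this, card_filter, sum_singleton]
    have hk : ∀ k, ∑ i ∈ range (playCount I n k (T + 1) ω), X n k (i + 1) ω =
        ∑ i ∈ range (playCount I n k T ω), X n k (i + 1) ω +
          if I n (T + 1) ω = k then reward X I n (T + 1) ω else 0 := by
      intro k
      by_cases h : I n (T + 1) ω = k
      · have h1 := hstep k
        rw [if_pos h] at h1
        rw [if_pos h, h1, sum_range_succ, reward, h, h1]
      · have h1 := hstep k
        rw [if_neg h, add_zero] at h1
        rw [if_neg h, h1, add_zero]
    rw [sum_congr rfl fun k _ ↦ hk k, sum_add_distrib, sum_ite_eq]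
    simp

variable {Ω : Type*} [MeasurableSpace Ω] {Pr : Measure Ω}
  {N K : ℕ} {μ : Fin K → unitInterval} {P : Matrix (Fin N) (Fin N) ℝ}
  {X : Fin N → Fin K → ℕ → Ω → ℝ} {Q : Fin N → ℕ → Ω → Fin N}
  {A : ℕ → ℕ} {S₀ : Fin N → Finset (Fin K)} {I M : Fin N → ℕ → Ω → Fin K}
  {star : Fin K} {ν ν' q d₀ : ℝ} {x d : Fin K → ℝ}

/-- The part of the fluctuations of partial reward sums that exceeds a linear bound. -/
noncomputable def excess {Ω : Type*} {N K : ℕ} (μ : Fin K → unitInterval)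
    (X : Fin N → Fin K → ℕ → Ω → ℝ) (η : ℝ) (n : Fin N) (k : Fin K) (F : ℕ → Finset ℕ) (T : ℕ)
    (ω : Ω) : ℝ :=
  ∑ v ∈ Icc 1 T, (v : ℝ) *
    {ω | η * #(F v) < |∑ i ∈ F v, (X n k (i + 1) ω - μ k)|}.indicator 1 ω

/-- A sum of v centred rewards is at most v in absolute value, and the excess contains the summand v
whenever the linear bound fails. As the excess covers all v at once, the bound may be used at a
random play count. -/
theorem abs_sum_le_excess (henv : IsEnvironment Pr μ P X Q) {η : ℝ} (hη : 0 ≤ η) (n : Fin N)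
    (k : Fin K) {F : ℕ → Finset ℕ} {T : ℕ} (hF : ∀ v ≤ T, #(F v) = v) {v : ℕ} (hv : v ≤ T)
    (ω : Ω) :
    |∑ i ∈ F v, (X n k (i + 1) ω - μ k)| ≤ η * v + excess μ X η n k F T ω := by
  have hnn : ∀ w ∈ Icc 1 T, 0 ≤ (w : ℝ) *
      {ω | η * #(F w) < |∑ i ∈ F w, (X n k (i + 1) ω - μ k)|}.indicator (1 : Ω → ℝ) ω :=
    fun w _ ↦ mul_nonneg (Nat.cast_nonneg w) (Set.indicator_nonneg (fun _ _ ↦ zero_le_one) _)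
  by_cases h : η * #(F v) < |∑ i ∈ F v, (X n k (i + 1) ω - μ k)|
  · have hle : |∑ i ∈ F v, (X n k (i + 1) ω - μ k)| ≤ v := by
      refine (abs_sum_le_sum_abs _ _).trans ?_
      calc ∑ i ∈ F v, |X n k (i + 1) ω - μ k| ≤ ∑ i ∈ F v, 1 := by
            refine sum_le_sum fun i _ ↦ ?_
            have h1 := henv.reward_mem_Icc n k (show 1 ≤ i + 1 by omega) ω
            have h2 := (μ k).2
            rw [abs_le]
            exact ⟨by linarith [h1.1, h2.2], by linarith [h1.2, h2.1]⟩
        _ = v := by simp [hF v hv]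
    have hv1 : 1 ≤ v := by
      by_contra hcon
      obtain rfl : v = 0 := by omega
      have : F 0 = ∅ := card_eq_zero.1 (hF 0 hv)
      simp [this] at h
    have h1 := single_le_sum hnn (mem_Icc.2 ⟨hv1, hv⟩)
    rw [Set.indicator_of_mem (by exact h), Pi.one_apply, mul_one] at h1
    have h2 : 0 ≤ η * v := by positivity
    unfold excess
    linarith
  · have := sum_nonneg hnn
    rw [hF v hv] at h
    unfold excess
    linarith

theorem measurableSet_deviation (henv : IsEnvironment Pr μ P X Q) (η : ℝ) (n : Fin N) (k : Fin K)
    (F : Finset ℕ) :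
    MeasurableSet {ω | η * #F < |∑ i ∈ F, (X n k (i + 1) ω - μ k)|} := by
  have h : Measurable fun ω ↦ ∑ i ∈ F, (X n k (i + 1) ω - μ k) :=
    Finset.measurable_fun_sum _ fun i _ ↦
      (henv.measurable_reward n k (i + 1) (by omega)).sub_const _
  exact measurableSet_lt measurable_const h.abs

/-- A linear error η V is harmless for suboptimal arms but not for the best arm, which may be played
almost T times. Its fluctuation is therefore written as the sum over all T rewards, of mean 0, minus
the unused rewards. There are as many of these as suboptimal plays, whence the factor 2η. -/
theorem sub_sum_reward_le (henv : IsEnvironment Pr μ P X Q) (I : Fin N → ℕ → Ω → Fin K)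
    (star : Fin K) {η : ℝ} (hη : 0 ≤ η) (n : Fin N) (T : ℕ) (ω : Ω) :
    T * (μ star : ℝ) - ∑ t ∈ Icc 1 T, reward X I n t ω ≤
      ∑ k ∈ univ \ {star}, (((μ star : ℝ) - μ k + 2 * η) * playCount I n k T ω +
        excess μ X η n k range T ω) +
      (excess μ X η n star (fun v ↦ Ico (T - v) T) T ω -
        ∑ i ∈ range T, (X n star (i + 1) ω - μ star)) := by
  set V : Fin K → ℕ := fun k ↦ playCount I n k T ω with hV
  have hVT : ∀ k, V k ≤ T := fun k ↦ playCount_le I n k ω T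
  have hsplit : ∀ g : Fin K → ℝ, ∑ k, g k = ∑ k ∈ univ \ {star}, g k + g star := fun g ↦ by
    rw [← sum_sdiff (subset_univ {star}), sum_singleton]
  have hVsum : (T : ℝ) = ∑ k ∈ univ \ {star}, (V k : ℝ) + V star := by
    rw [← hsplit fun k ↦ (V k : ℝ)]
    exact_mod_cast (sum_playCount I n ω T).symm
  have hX : ∀ k, ∑ i ∈ range (V k), X n k (i + 1) ω =
      ∑ i ∈ range (V k), (X n k (i + 1) ω - μ k) + V k * μ k := by
    intro k
    simp [sum_sub_distrib]
  rw [sum_reward_eq, hsplit]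
  have hstar : -∑ i ∈ range (V star), (X n star (i + 1) ω - μ star) ≤
      η * (T - V star) + excess μ X η n star (fun v ↦ Ico (T - v) T) T ω -
        ∑ i ∈ range T, (X n star (i + 1) ω - μ star) := by
    -- Final segments: with v = T - V the set is exactly the indices of the unused rewards.
    have h1 := abs_sum_le_excess henv hη n star (F := fun v ↦ Ico (T - v) T) (T := T)
      (fun v hv ↦ by simp; omega) (v := T - V star) (by omega) ω
    simp only [Nat.sub_sub_self (hVT star)] at h1
    rw [Nat.cast_sub (hVT star)] at h1
    have h2 := sum_range_add_sum_Ico (fun i ↦ X n star (i + 1) ω - μ star) (hVT star)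
    have h3 := le_abs_self (∑ i ∈ Ico (V star) T, (X n star (i + 1) ω - μ star))
    linarith
  have hother : ∀ k, -∑ i ∈ range (V k), (X n k (i + 1) ω - μ k) ≤
      η * V k + excess μ X η n k range T ω := fun k ↦
    (neg_le_abs _).trans (abs_sum_le_excess henv hη n k (fun v _ ↦ card_range v) (hVT k) ω)
  have hsum := sum_le_sum fun k (_ : k ∈ univ \ {star}) ↦ hother k
  rw [sum_neg_distrib, sum_add_distrib, ← mul_sum] at hsum
  have e1 : ∑ k ∈ univ \ {star}, ∑ i ∈ range (V k), X n k (i + 1) ω =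
      ∑ k ∈ univ \ {star}, ∑ i ∈ range (V k), (X n k (i + 1) ω - μ k) +
        ∑ k ∈ univ \ {star}, (V k : ℝ) * μ k := by
    rw [← sum_add_distrib]
    exact sum_congr rfl fun k _ ↦ hX k
  have e2 : ∑ k ∈ univ \ {star}, (((μ star : ℝ) - μ k + 2 * η) * V k +
        excess μ X η n k range T ω) =
      (μ star + 2 * η) * ∑ k ∈ univ \ {star}, (V k : ℝ) -
        ∑ k ∈ univ \ {star}, (V k : ℝ) * μ k +
        ∑ k ∈ univ \ {star}, excess μ X η n k range T ω := by
    rw [mul_sum, ← sum_sub_distrib, ← sum_add_distrib]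
    exact sum_congr rfl fun k _ ↦ by ring
  have e3 := hX star
  rw [e1, e3, e2]
  set R := ∑ k ∈ univ \ {star}, (V k : ℝ)
  have e4 : (T : ℝ) * μ star = R * μ star + V star * μ star := by rw [hVsum]; ring
  have e5 : η * ((T : ℝ) - V star) = η * R := by rw [hVsum]; ring
  rw [e5] at hstar
  linarith

variable [IsProbabilityMeasure Pr]

theorem integrable_excess (henv : IsEnvironment Pr μ P X Q) (η : ℝ) (n : Fin N) (k : Fin K)
    (F : ℕ → Finset ℕ) (T : ℕ) : Integrable (excess μ X η n k F T) Pr :=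
  integrable_finsetSum _ fun v _ ↦ ((integrable_const (1 : ℝ)).indicator
    (measurableSet_deviation henv η n k (F v))).const_mul _

theorem integral_excess_le (henv : IsEnvironment Pr μ P X Q) {η : ℝ} (hη : 0 < η) (n : Fin N)
    (k : Fin K) {F : ℕ → Finset ℕ} {T : ℕ} (hF : ∀ v ≤ T, #(F v) = v) :
    ∫ ω, excess μ X η n k F T ω ∂Pr ≤
      ∑' v : ℕ, 2 * ((v : ℝ) * Real.exp (-(2 * η ^ 2 * v))) := by
  have hi : ∀ v : ℕ, Integrable (fun ω ↦ (v : ℝ) *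
      {ω | η * #(F v) < |∑ i ∈ F v, (X n k (i + 1) ω - μ k)|}.indicator 1 ω) Pr := fun v ↦
    ((integrable_const (1 : ℝ)).indicator (measurableSet_deviation henv η n k (F v))).const_mul _
  unfold excess
  rw [integral_finsetSum _ fun v _ ↦ hi v]
  refine le_trans (sum_le_sum fun v hv ↦ ?_)
    (((summable_mul_exp_neg_mul_nat (show 0 < 2 * η ^ 2 by positivity)).mul_left 2).sum_le_tsum
      (Icc 1 T) fun v _ ↦ by positivity)
  rw [integral_const_mul, integral_indicator_one (measurableSet_deviation henv η n k (F v))]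
  have h := henv.measureReal_deviation_le n k (F v) hη.le
  have hc := hF v (mem_Icc.1 hv).2
  have h2 : Real.exp (-(2 * η ^ 2 * #(F v))) = Real.exp (-(2 * η ^ 2 * v)) := by rw [hc]
  rw [h2] at h
  have hv0 : (0 : ℝ) ≤ v := Nat.cast_nonneg v
  nlinarith

theorem integrable_reward_round (henv : IsEnvironment Pr μ P X Q) (hrun : IsRun A S₀ X Q I M)
    (hA₀ : A 0 = 0) (hA : StrictMono A) (n : Fin N) {t : ℕ} (ht : 1 ≤ t) :
    Integrable (reward X I n t) Pr :=
  Integrable.of_mem_Icc 0 1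
    (measurable_reward_round henv ht
      fun _ hs _ ↦ hrun.measurable_play henv hA₀ hA n hs).aemeasurable
    (Eventually.of_forall fun ω ↦ henv.reward_mem_Icc n _ (one_le_playCount_self ht ω) ω)

theorem regret_le (henv : IsEnvironment Pr μ P X Q) (hrun : IsRun A S₀ X Q I M)
    (hA₀ : A 0 = 0) (hA : StrictMono A) {η : ℝ} (hη : 0 < η) (n : Fin N) (T : ℕ) :
    regret Pr (μ star) X I n T ≤
      ∑ k ∈ univ \ {star}, ((μ star : ℝ) - μ k + 2 * η) * ∫ ω, (playCount I n k T ω : ℝ) ∂Pr +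
      (#(univ \ {star} : Finset (Fin K)) + 1) *
        ∑' v : ℕ, 2 * ((v : ℝ) * Real.exp (-(2 * η ^ 2 * v))) := by
  have hr : ∀ t ∈ Icc 1 T, Integrable (fun ω ↦ reward X I n t ω) Pr := fun t ht ↦
    integrable_reward_round henv hrun hA₀ hA n (mem_Icc.1 ht).1
  have h1 : regret Pr (μ star) X I n T =
      ∫ ω, (T * (μ star : ℝ) - ∑ t ∈ Icc 1 T, reward X I n t ω) ∂Pr := by
    rw [integral_sub (integrable_const _) (integrable_finsetSum _ hr), integral_finsetSum _ hr]
    simp [regret]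
  have hV := fun k ↦ (integrable_playCount henv hrun hA₀ hA n k T).const_mul
    ((μ star : ℝ) - μ k + 2 * η)
  have hE := fun k ↦ integrable_excess henv η n k range T
  have hE' := integrable_excess henv η n star (fun v ↦ Ico (T - v) T) T
  have hXi : ∀ i ∈ range T, Integrable (fun ω ↦ X n star (i + 1) ω - (μ star : ℝ)) Pr :=
    fun i _ ↦ (henv.integrable_reward n star (by omega)).sub (integrable_const _)
  have hX := integrable_finsetSum _ hXi
  have hX0 : ∫ ω, ∑ i ∈ range T, (X n star (i + 1) ω - (μ star : ℝ)) ∂Pr = 0 := by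
    rw [integral_finsetSum _ hXi]
    refine sum_eq_zero fun i _ ↦ ?_
    rw [integral_sub (henv.integrable_reward n star (by omega)) (integrable_const _),
      henv.integral_reward n star (by omega)]
    simp
  have hVE : ∀ k, Integrable (fun ω ↦ ((μ star : ℝ) - μ k + 2 * η) * playCount I n k T ω +
      excess μ X η n k range T ω) Pr := fun k ↦ (hV k).add (hE k)
  have hEX : Integrable (fun ω ↦ excess μ X η n star (fun v ↦ Ico (T - v) T) T ω -
      ∑ i ∈ range T, (X n star (i + 1) ω - (μ star : ℝ))) Pr := hE'.sub hX
  rw [h1]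
  refine (integral_mono ((integrable_const _).sub (integrable_finsetSum _ hr))
    ((integrable_finsetSum _ fun k _ ↦ hVE k).add hEX)
    fun ω ↦ sub_sum_reward_le henv I star hη.le n T ω).trans ?_
  rw [integral_add' (integrable_finsetSum _ fun k _ ↦ hVE k) hEX,
    integral_finsetSum _ fun k _ ↦ hVE k, integral_sub hE' hX, hX0, sub_zero,
    sum_congr rfl fun k _ ↦ integral_add (hV k) (hE k), sum_add_distrib,
    sum_congr rfl fun k _ ↦ integral_const_mul _ _]
  have h2 := sum_le_sum fun k (_ : k ∈ univ \ {star}) ↦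
    integral_excess_le henv hη n k (T := T) fun v _ ↦ card_range v
  rw [sum_const, nsmul_eq_mul] at h2
  have h3 := integral_excess_le henv hη n star (F := fun v ↦ Ico (T - v) T) (T := T)
    (fun v hv ↦ by simp; omega)
  linarith

theorem exists_regret_le (henv : IsEnvironment Pr μ P X Q)
    (hrun : IsRun A S₀ X Q I M) (hth : Thresholds μ star ν ν' q d₀ x d) (hA₀ : A 0 = 0)
    (hA : StrictMono A) {C θ : ℝ} (hC : 1 ≤ C) (hθ : 0 < θ)
    (hlength : ∀ j : ℕ, 1 ≤ j →
      C⁻¹ * (j : ℝ) ^ θ ≤ (A j : ℝ) - A (j - 1) ∧ (A j : ℝ) - A (j - 1) ≤ C * (j : ℝ) ^ θ)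
    (hconn : @Quiver.IsStronglyConnected (Fin N) P.toQuiver) (hS : ∃ a, star ∈ S₀ a)
    (hstar : ∀ k, k ≠ star → μ k < μ star) {η : ℝ} (hη : 0 < η) (n : Fin N) :
    ∃ C₂ : ℝ, ∀ T, regret Pr (μ star) X I n T ≤
      C₂ + (∑ k ∈ S₀ n \ {star}, ((μ star : ℝ) - μ k + 2 * η) / d k) *
        Real.log (explore T) := by
  obtain ⟨C₁, hC₁⟩ := exists_integral_playCount_le henv hrun hth hA₀ hA hC hθ hlength hconn hS
  refine ⟨∑ k ∈ univ \ {star}, ((μ star : ℝ) - μ k + 2 * η) * C₁ +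
      (#(univ \ {star} : Finset (Fin K)) + 1) *
        ∑' v : ℕ, 2 * ((v : ℝ) * Real.exp (-(2 * η ^ 2 * v))), fun T ↦ ?_⟩
  refine (regret_le henv hrun hA₀ hA hη n T).trans ?_
  have h1 : ∑ k ∈ univ \ {star},
      ((μ star : ℝ) - μ k + 2 * η) * ∫ ω, (playCount I n k T ω : ℝ) ∂Pr ≤
      ∑ k ∈ univ \ {star}, (((μ star : ℝ) - μ k + 2 * η) * C₁ +
        if k ∈ S₀ n then ((μ star : ℝ) - μ k + 2 * η) / d k * Real.log (explore T) else 0) := by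
    refine sum_le_sum fun k hk ↦ ?_
    have hk' : k ≠ star := by simpa using hk
    have hΔ : (μ k : ℝ) < μ star := hstar k hk'
    have h := mul_le_mul_of_nonneg_left (hC₁ n k hk' T)
      (show 0 ≤ (μ star : ℝ) - μ k + 2 * η by linarith)
    refine h.trans_eq ?_
    split_ifs <;> ring
  rw [sum_add_distrib, ← sum_filter] at h1
  have h2 : (univ \ {star} : Finset (Fin K)).filter (fun k ↦ k ∈ S₀ n) = S₀ n \ {star} := by
    ext k; simp [and_comm]
  rw [h2, ← sum_mul (S₀ n \ {star})] at h1
  linarith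

/-! ### Asymptotics and conclusion -/

theorem eventually_add_mul_log_explore_le (c r : ℝ) {ε : ℝ} (hε : 0 < ε) :
    ∀ᶠ T : ℕ in atTop, c + r * Real.log (explore T) ≤ (r + ε) * Real.log T := by
  have hlog : Tendsto (fun t : ℕ ↦ Real.log t) atTop atTop :=
    Real.tendsto_log_atTop.comp tendsto_natCast_atTop_atTop
  have h1 : Tendsto (fun T : ℕ ↦ c / Real.log T + r * (Real.log (explore T) / Real.log T)) atTop
      (nhds (0 + r * 1)) :=
    (tendsto_const_nhds.div_atTop hlog).add (tendsto_log_explore_div_log.const_mul r)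
  filter_upwards [h1.eventually (gt_mem_nhds (show 0 + r * 1 < r + ε by linarith)),
    hlog.eventually_gt_atTop 0] with T hT hpos
  have e : c + r * Real.log (explore T) =
      (c / Real.log T + r * (Real.log (explore T) / Real.log T)) * Real.log T := by
    field_simp
  rw [e]
  exact mul_le_mul_of_nonneg_right hT.le hpos.le

/-- For a positive gap, the ratio of gap and divergence is approximated by divergence lower
bounds. -/
theorem exists_div_le {g ε : ℝ} {κ : ℝ≥0∞} (hg : 0 < g) (hε : 0 < ε) (hκ : κ ≠ 0) :
    ∃ d, 0 < d ∧ ENNReal.ofReal d < κ ∧ g / d ≤ (ENNReal.ofReal g / κ).toReal + ε := by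
  have hc : 0 ≤ (ENNReal.ofReal g / κ).toReal := ENNReal.toReal_nonneg
  refine ⟨g / ((ENNReal.ofReal g / κ).toReal + ε), by positivity, ?_, ?_⟩
  · rcases eq_or_ne κ ∞ with rfl | hκ'
    · exact ENNReal.ofReal_lt_top
    have hκ0 : 0 < κ.toReal := ENNReal.toReal_pos hκ hκ'
    rw [ENNReal.ofReal_lt_iff_lt_toReal (by positivity) hκ', ENNReal.toReal_div,
      ENNReal.toReal_ofReal hg.le, div_lt_iff₀ (by positivity), mul_add, mul_div_cancel₀ _ hκ0.ne']
    have := mul_pos hκ0 hε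
    linarith
  · rw [div_div_cancel₀ hg.ne']

theorem eventually_regret_le (henv : IsEnvironment Pr μ P X Q)
    (hrun : IsRun A S₀ X Q I M) (hA₀ : A 0 = 0)
    (hA : StrictMono A) {C θ : ℝ} (hC : 1 ≤ C) (hθ : 0 < θ)
    (hlength : ∀ j : ℕ, 1 ≤ j →
      C⁻¹ * (j : ℝ) ^ θ ≤ (A j : ℝ) - A (j - 1) ∧ (A j : ℝ) - A (j - 1) ≤ C * (j : ℝ) ^ θ)
    (hconn : @Quiver.IsStronglyConnected (Fin N) P.toQuiver) (hS : ∃ a, star ∈ S₀ a)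
    (hstar : ∀ k, k ≠ star → μ k < μ star) {ε : ℝ} (hε : 0 < ε) (n : Fin N) :
    ∀ᶠ T : ℕ in atTop, regret Pr (μ star) X I n T ≤
      (∑ k ∈ S₀ n \ {star},
        (ENNReal.ofReal ((μ star : ℝ) - μ k) / klBer (μ k) (μ star)).toReal + ε) *
        Real.log T := by
  set c : Fin K → ℝ := fun k ↦
    (ENNReal.ofReal ((μ star : ℝ) - μ k) / klBer (μ k) (μ star)).toReal with hc
  have hc0 : ∀ k, 0 ≤ c k := fun k ↦ ENNReal.toReal_nonneg
  -- Positive thresholds need a positive best mean. If it is 0, the regret is at most 0 because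
  -- rewards are nonnegative.
  rcases (μ star).2.1.eq_or_lt with h0 | hpos
  · filter_upwards [eventually_ge_atTop 1] with T hT
    have h1 : regret Pr (μ star) X I n T ≤ 0 := by
      unfold regret
      rw [← h0, mul_zero, zero_sub, neg_nonpos]
      exact sum_nonneg fun t ht ↦ integral_nonneg fun ω ↦
        (henv.reward_mem_Icc n _ (one_le_playCount_self (mem_Icc.1 ht).1 ω) ω).1
    refine h1.trans (mul_nonneg (add_nonneg (sum_nonneg fun k _ ↦ hc0 k) hε.le) ?_)
    exact Real.log_nonneg (by exact_mod_cast hT)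
  -- The error is split in thirds: approximating the divergences by `d`, the fluctuation slope `η`,
  -- and replacing log f(T) and the additive constant by log T.
  have hε' : 0 < ε / (3 * (K + 1)) := by positivity
  have hd : ∀ k, ∃ d, k ≠ star → 0 < d ∧ ENNReal.ofReal d < klBer (μ k) (μ star) ∧
      ((μ star : ℝ) - μ k) / d ≤ c k + ε / (3 * (K + 1)) := by
    intro k
    by_cases hk : k = star
    · exact ⟨0, fun h ↦ absurd hk h⟩
    · have hlt : (μ k : ℝ) < μ star := hstar k hk
      obtain ⟨d, h⟩ := exists_div_le (sub_pos.2 hlt) hε'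
        (klBer_pos (μ k).2.1 hlt (μ star).2.2).ne'
      exact ⟨d, fun _ ↦ h⟩
  choose d hd using hd
  obtain ⟨ν, ν', q, d₀, x, hth⟩ := exists_thresholds hstar hpos (fun k hk ↦ (hd k hk).1)
    (fun k hk ↦ (hd k hk).2.1)
  set D : ℝ := ∑ k ∈ S₀ n \ {star}, 1 / d k with hD
  have hdpos : ∀ k ∈ S₀ n \ {star}, 0 < d k := fun k hk ↦
    (hd k (by simp only [Finset.mem_sdiff, mem_singleton] at hk; exact hk.2)).1
  have hD0 : 0 ≤ D := sum_nonneg fun k hk ↦ (one_div_pos.2 (hdpos k hk)).le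
  set η : ℝ := ε / (6 * (D + 1)) with hη
  have hη0 : 0 < η := by positivity
  obtain ⟨C₂, hC₂⟩ := exists_regret_le henv hrun hth hA₀ hA hC hθ hlength hconn hS hstar hη0 n
  set r : ℝ := ∑ k ∈ S₀ n \ {star}, ((μ star : ℝ) - μ k + 2 * η) / d k with hr
  have hr_le : r ≤ ∑ k ∈ S₀ n \ {star}, c k + 2 * (ε / 3) := by
    have e1 : r = ∑ k ∈ S₀ n \ {star}, ((μ star : ℝ) - μ k) / d k + 2 * η * D := by
      rw [hr, hD, mul_sum, ← sum_add_distrib]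
      exact sum_congr rfl fun k _ ↦ by ring
    have h1 : ∑ k ∈ S₀ n \ {star}, ((μ star : ℝ) - μ k) / d k ≤
        ∑ k ∈ S₀ n \ {star}, (c k + ε / (3 * (K + 1))) :=
      sum_le_sum fun k hk ↦
        (hd k (by simp only [Finset.mem_sdiff, mem_singleton] at hk; exact hk.2)).2.2
    rw [sum_add_distrib, sum_const, nsmul_eq_mul] at h1
    have h2 : (#(S₀ n \ {star}) : ℝ) * (ε / (3 * (K + 1))) ≤ ε / 3 := by
      have h3 : (#(S₀ n \ {star}) : ℝ) ≤ K + 1 := by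
        have := card_le_univ (S₀ n \ {star})
        rw [Fintype.card_fin] at this
        have : (#(S₀ n \ {star}) : ℝ) ≤ K := by exact_mod_cast this
        linarith
      calc (#(S₀ n \ {star}) : ℝ) * (ε / (3 * (K + 1))) ≤ (K + 1) * (ε / (3 * (K + 1))) := by
            gcongr
        _ = ε / 3 := by field_simp
    have h4 : 2 * η * D ≤ ε / 3 := by
      rw [hη]
      calc 2 * (ε / (6 * (D + 1))) * D ≤ 2 * (ε / (6 * (D + 1))) * (D + 1) := by gcongr; linarith
        _ = ε / 3 := by field_simp; norm_num
    linarith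
  filter_upwards [eventually_add_mul_log_explore_le C₂ r (show 0 < ε / 3 by positivity),
    eventually_ge_atTop 1] with T hT hT1
  have hlog : 0 ≤ Real.log (T : ℝ) := Real.log_nonneg (by exact_mod_cast hT1)
  refine (hC₂ T).trans (hT.trans (mul_le_mul_of_nonneg_right ?_ hlog))
  linarith

theorem limsup_div_log_le {u : ℕ → ℝ} {c : ℝ}
    (h : ∀ ε > 0, ∀ᶠ T : ℕ in atTop, u T ≤ (c + ε) * Real.log T) :
    limsup (fun T : ℕ ↦ ((u T / Real.log T : ℝ) : EReal)) atTop ≤ c := by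
  refine EReal.le_of_forall_lt_iff_le.1 fun z hz ↦ ?_
  have hz' : c < z := EReal.coe_lt_coe_iff.1 hz
  refine limsup_le_of_le (by isBoundedDefault) ?_
  filter_upwards [h (z - c) (sub_pos.2 hz'), eventually_ge_atTop 2] with T hT hT2
  have hlog : 0 < Real.log (T : ℝ) := Real.log_pos (by exact_mod_cast hT2)
  rw [EReal.coe_le_coe_iff, div_le_iff₀ hlog]
  rwa [add_sub_cancel] at hT

end AOGB

theorem theorem1 {Ω : Type*} [MeasurableSpace Ω] (Pr : Measure Ω) [IsProbabilityMeasure Pr]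
    {N K : ℕ} (μ : Fin K → unitInterval) (star : Fin K) (hstar : ∀ k, k ≠ star → μ k < μ star)
    (P : Matrix (Fin N) (Fin N) ℝ) (hP : P ∈ Matrix.rowStochastic ℝ (Fin N))
    (hconn : @Quiver.IsStronglyConnected (Fin N) P.toQuiver)
    (A : ℕ → ℕ) (hA₀ : A 0 = 0) (hA : StrictMono A)
    (C θ : ℝ) (hC : 1 ≤ C) (hθ : 0 < θ)
    (hlength : ∀ j : ℕ, 1 ≤ j →
      C⁻¹ * (j : ℝ) ^ θ ≤ (A j : ℝ) - A (j - 1) ∧ (A j : ℝ) - A (j - 1) ≤ C * (j : ℝ) ^ θ)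
    (S₀ : Fin N → Finset (Fin K)) (hS₀ : ∀ n, (S₀ n).Nonempty) (hpart : ∀ k, ∃! n, k ∈ S₀ n)
    (X : Fin N → Fin K → ℕ → Ω → ℝ) (Q : Fin N → ℕ → Ω → Fin N)
    (henv : AOGB.IsEnvironment Pr μ P X Q)
    (I M : Fin N → ℕ → Ω → Fin K) (hrun : AOGB.IsRun A S₀ X Q I M) :
    (∀ n : Fin N,
      limsup (fun T : ℕ ↦
        ((AOGB.regret Pr (μ star) X I n T / Real.log T : ℝ) : EReal)) atTop
      ≤ ((∑ k ∈ S₀ n \ {star},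
          ENNReal.ofReal ((μ star : ℝ) - μ k) / AOGB.klBer (μ k) (μ star) : ℝ≥0∞) : EReal)) ∧
    limsup (fun T : ℕ ↦
        (((∑ n, AOGB.regret Pr (μ star) X I n T) / Real.log T : ℝ) : EReal)) atTop
      ≤ ((∑ k ∈ univ \ {star},
          ENNReal.ofReal ((μ star : ℝ) - μ k) / AOGB.klBer (μ k) (μ star) : ℝ≥0∞) : EReal) := by
  have hfin : ∀ k, k ≠ star →
      ENNReal.ofReal ((μ star : ℝ) - μ k) / AOGB.klBer (μ k) (μ star) ≠ ∞ := fun k hk ↦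
    ENNReal.div_ne_top ENNReal.ofReal_ne_top
      (AOGB.klBer_pos (μ k).2.1 (show (μ k : ℝ) < μ star from hstar k hk) (μ star).2.2).ne'
  have hcoe : ∀ s : Finset (Fin K), ((∑ k ∈ s \ {star},
      ENNReal.ofReal ((μ star : ℝ) - μ k) / AOGB.klBer (μ k) (μ star) : ℝ≥0∞) : EReal) =
      ((∑ k ∈ s \ {star},
        (ENNReal.ofReal ((μ star : ℝ) - μ k) / AOGB.klBer (μ k) (μ star)).toReal : ℝ) :
        EReal) := by
    intro s
    have h : ∀ k ∈ s \ {star},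
        ENNReal.ofReal ((μ star : ℝ) - μ k) / AOGB.klBer (μ k) (μ star) ≠ ∞ := fun k hk ↦
      hfin k (by simp only [Finset.mem_sdiff, mem_singleton] at hk; exact hk.2)
    rw [← ENNReal.toReal_sum h, EReal.coe_ennreal_toReal (ENNReal.sum_ne_top.2 h)]
  have hev := fun (ε : ℝ) (hε : 0 < ε) (n : Fin N) ↦ AOGB.eventually_regret_le henv hrun hA₀ hA
    hC hθ hlength hconn (hpart star).exists hstar hε n
  refine ⟨fun n ↦ ?_, ?_⟩
  · rw [hcoe]
    exact AOGB.limsup_div_log_le fun ε hε ↦ hev ε hε n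
  · rw [hcoe]
    refine AOGB.limsup_div_log_le fun ε hε ↦ ?_
    have hε' : 0 < ε / (N + 1) := by positivity
    filter_upwards [eventually_all.2 fun n ↦ hev _ hε' n, eventually_ge_atTop 1] with T hT hT1
    have hlog : 0 ≤ Real.log (T : ℝ) := Real.log_nonneg (by exact_mod_cast hT1)
    refine (sum_le_sum fun n _ ↦ hT n).trans ?_
    rw [← sum_mul, sum_add_distrib]
    refine mul_le_mul_of_nonneg_right (add_le_add (le_of_eq ?_) ?_) hlog
    -- The sticky sets partition the arms, so each suboptimal arm is counted for exactly one agent.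
    · rw [sum_comm' (t' := univ \ {star}) (s' := fun k ↦ {n | k ∈ S₀ n})
        (fun n k ↦ by simp)]
      refine sum_congr rfl fun k _ ↦ ?_
      obtain ⟨n, hn, huniq⟩ := hpart k
      have : ({n | k ∈ S₀ n} : Finset (Fin N)) = {n} := by
        ext m
        simp only [mem_filter, mem_univ, true_and, mem_singleton]
        exact ⟨fun h ↦ huniq m h, fun h ↦ h ▸ hn⟩
      rw [this, sum_singleton]
    · rw [sum_const, card_univ, Fintype.card_fin, nsmul_eq_mul]
      have : (0 : ℝ) ≤ N := Nat.cast_nonneg N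
      calc (N : ℝ) * (ε / (N + 1)) ≤ (N + 1) * (ε / (N + 1)) := by gcongr; linarith
        _ = ε := by field_simp
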